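/- For every $\epsilon>0$ there exists $\delta>0$ such that the following holds. Let $G$ be a $5$-partite graph on pairwise disjoint vertex sets $V_1,\dots,V_5$ with $|V_1|=\cdots=|V_5|=n$, such that every edge of $G$ lies between $V_i$ and $V_{i+1}$ for some $i$ (indices taken mod $5$). Suppose that (a) $G$ has at most $\delta n^2$ copies of the $4$-cycle $C_4$ whose vertices lie in exactly two of the parts $V_1,\dots,V_5$, and (b) $G$ has at most $\delta n^{5/2}$ copies of the $5$-cycle $C_5$. Then $G$ can be made $C_5$-free by removing at most $\epsilon n^{3/2}$ edges. Here a copy of $C_k$ in $G$ is a (not necessarily induced) subgraph of $G$ isomorphic to the cycle of length $k$, and $G$ is $C_5$-free if it contains no copy of $C_5$. -/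

import Mathlib

/-- `part` assigns to each vertex of `G` the index (mod 5) of the vertex set containing it, so that
the five vertex sets are the fibres of `part`. The graph `G` is cyclically 5-partite with parts of
size `n` if each of the five vertex sets has exactly `n` elements and every edge joins the `i`-th
vertex set to the `(i + 1)`-st one for some `i` (mod 5). -/
structure IsCyclicFivePartite {V : Type*} (G : SimpleGraph V) (part : V → ZMod 5) (n : ℕ) :
    Prop where
  ncard_part : ∀ i : ZMod 5, {v : V | part v = i}.ncard = n
  adj : ∀ u v : V, G.Adj u v → part v = part u + 1 ∨ part u = part v + 1

/-- The number of (unlabelled, not necessarily induced) copies of `C₄` in `G`, that is, of subgraphs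
of `G` isomorphic to the 4-cycle, whose vertices lie in exactly two of the vertex sets. -/
noncomputable def twoPartC4Count {V : Type*} (G : SimpleGraph V) (part : V → ZMod 5) : ℕ :=
  {H : G.Subgraph | Nonempty (SimpleGraph.cycleGraph 4 ≃g H.coe) ∧
    (part '' H.verts).ncard = 2}.ncard

/-! Direct every edge from each part to the next and let `A` be the resulting 0/1 matrix on N = 5n
vertices, with s = √N and g = s • A. A nondegenerate rectangle of `A` is a C₄ in two parts. A closed
directed 5-walk visits all five parts, hence is a C₅, and every C₅ arises so, because five steps ±1
add up to 0 mod 5 only if all are equal (`cyclic_walk`). The theorem thus reduces to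
`pentagon_removal`: few rectangles and few closed 5-walks allow all closed 5-walks to be destroyed
at small cost.

Scarcity of C₄ enters through one inequality: the codegree of two distinct vertices is at most 1
plus the number of rectangles on them. It has three consequences. Degrees have a bounded normalized
second moment (`sum_sq_degree_le`), so edges at vertices of degree above K s can be discarded.
Averages of g over classes of linear size are bounded in L² (`energy_le`), so energy increment works
although g itself is unbounded. The numbers of 2-walks between pairs have bounded mean square
(`sum_sq_mul_self_le`).

Strong regularity (`exists_strong_regular`) gives partitions P, Q₁, Q₂, each refining the one
before, such that g is close in cut norm to its averages over Q₁ and Q₂, with errors small in terms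
of the class sizes of P and Q₁ respectively, while the energies of all three nearly agree. Edges are
deleted between classes of P where the average is small or where the Q₁- or Q₂-average deviates from
it. A surviving pentagon yields five classes of P between which most entries of the averages over Q₁
and Q₂ are at least h.

The counting lemma `pentSum_ge` then finds too many pentagons. For a base vertex x, the opposite
edge is counted between the vertices reached from x by two steps forwards and two steps backwards;
indicators of these sets are cut-norm test functions, so that edge may be replaced by its
Q₁-average. Passing between indicators and walk counts requires truncation, paid for by the second
moment of 2-walks. What remains counts 4-walks weighted by a function constant on classes of Q₁;
there the four edges are replaced by their Q₂-averages. This loses the inverse square of the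
relative class size of Q₁, which is why Q₂ is chosen after Q₁. -/

namespace SparseRemoval

open Finset Matrix

variable {V : Type*} [Fintype V]

/-! ### Averaging over partitions, energy and the cut norm. -/

open scoped Classical in
/-- The size of the class of `x`. -/
noncomputable def cellCard (r : Setoid V) (x : V) : ℝ := #{y | r x y}

open scoped Classical in
/-- The matrix that averages a function over the classes of `r`. -/
noncomputable def avg (r : Setoid V) : Matrix V V ℝ :=
  fun x y => if r x y then (cellCard r x)⁻¹ else 0

lemma cellCard_pos (r : Setoid V) (x : V) : 0 < cellCard r x := by
  classical
  unfold cellCard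
  exact_mod_cast card_pos.2 ⟨x, by simp⟩

lemma cellCard_congr {r : Setoid V} {x y : V} (h : r x y) : cellCard r x = cellCard r y := by
  classical
  unfold cellCard
  congr 2
  ext z
  simp only [mem_filter, mem_univ, true_and]
  exact ⟨fun hz => r.trans (r.symm h) hz, fun hz => r.trans h hz⟩

lemma avg_nonneg (r : Setoid V) (x y : V) : 0 ≤ avg r x y := by
  unfold avg
  split_ifs
  · exact (inv_pos.2 (cellCard_pos r x)).le
  · rfl

lemma avg_symm (r : Setoid V) (x y : V) : avg r x y = avg r y x := by
  unfold avg
  by_cases h : r x y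
  · rw [if_pos h, if_pos (r.symm h), cellCard_congr h]
  · rw [if_neg h, if_neg (fun h' => h (r.symm h'))]

lemma avg_transpose (r : Setoid V) : (avg r)ᵀ = avg r := by
  ext x y
  exact avg_symm r y x

lemma avg_congr {r : Setoid V} {x x' : V} (h : r x x') (y : V) : avg r x y = avg r x' y := by
  unfold avg
  by_cases hy : r x y
  · rw [if_pos hy, if_pos (r.trans (r.symm h) hy), cellCard_congr h]
  · rw [if_neg hy, if_neg (fun h' => hy (r.trans h h'))]

lemma sum_avg (r : Setoid V) (x : V) : ∑ y, avg r x y = 1 := by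
  classical
  unfold avg
  rw [← sum_filter, sum_const, nsmul_eq_mul]
  exact mul_inv_cancel₀ (cellCard_pos r x).ne'

lemma sum_avg_left (r : Setoid V) (y : V) : ∑ x, avg r x y = 1 := by
  simp_rw [avg_symm r _ y]
  exact sum_avg r y

lemma avg_le {r : Setoid V} {t : ℝ} (ht : 0 < t) {x : V} (h : t ≤ cellCard r x) (y : V) :
    avg r x y ≤ t⁻¹ := by
  unfold avg
  split_ifs
  · exact inv_anti₀ ht h
  · exact (inv_pos.2 ht).le

lemma sum_avg_mul_of_const {r : Setoid V} {u : V → ℝ} (hu : ∀ x y, r x y → u x = u y) (x : V) :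
    ∑ y, avg r x y * u y = u x := by
  have : ∀ y, avg r x y * u y = avg r x y * u x := by
    intro y
    by_cases h : r x y
    · rw [hu x y h]
    · simp [avg, h]
  simp_rw [this]
  rw [← sum_mul, sum_avg, one_mul]

lemma avg_mul_avg {r s : Setoid V} (h : r ≤ s) : avg r * avg s = avg s := by
  ext x y
  rw [mul_apply]
  exact sum_avg_mul_of_const (fun a b hab => avg_congr (h hab) y) x

/-- The matrix obtained from `g` by averaging over the products of the classes of `r`. -/
noncomputable def step (r : Setoid V) (g : Matrix V V ℝ) : Matrix V V ℝ := avg r * g * avg r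

lemma step_transpose (r : Setoid V) (g : Matrix V V ℝ) : (step r g)ᵀ = step r gᵀ := by
  simp [step, transpose_mul, avg_transpose, Matrix.mul_assoc]

lemma step_apply (r : Setoid V) (g : Matrix V V ℝ) (x y : V) :
    step r g x y = ∑ a, ∑ b, avg r x a * g a b * avg r b y := by
  simp only [step, mul_apply, sum_mul]
  exact sum_comm

lemma step_nonneg {r : Setoid V} {g : Matrix V V ℝ} (hg : ∀ x y, 0 ≤ g x y) (x y : V) :
    0 ≤ step r g x y := by
  rw [step_apply]
  exact sum_nonneg fun a _ => sum_nonneg fun b _ =>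
    mul_nonneg (mul_nonneg (avg_nonneg _ _ _) (hg _ _)) (avg_nonneg _ _ _)

lemma step_congr {r : Setoid V} (g : Matrix V V ℝ) {x x' y y' : V} (hx : r x x') (hy : r y y') :
    step r g x y = step r g x' y' := by
  simp only [step_apply, avg_congr hx, avg_symm r _ y, avg_symm r _ y', avg_congr hy]

lemma step_of_const {r : Setoid V} {F : Matrix V V ℝ}
    (hF : ∀ x x' y y', r x x' → r y y' → F x y = F x' y') : step r F = F := by
  have h1 : avg r * F = F := by
    ext x y
    rw [mul_apply]
    exact sum_avg_mul_of_const (fun a b hab => hF a b y y hab (r.refl y)) x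
  rw [step, h1]
  ext x y
  rw [mul_apply]
  simp_rw [avg_symm r _ y, mul_comm (F x _)]
  exact sum_avg_mul_of_const (fun a b hab => hF x x a b (r.refl x) hab) y

lemma step_step {r s : Setoid V} (h : r ≤ s) (g : Matrix V V ℝ) :
    step r (step s g) = step s g :=
  step_of_const fun _ _ _ _ hx hy => step_congr g (h hx) (h hy)

lemma sum_step_row_le {r : Setoid V} {g : Matrix V V ℝ} {B : ℝ} (hg : ∀ x, ∑ y, g x y ≤ B)
    (x : V) : ∑ y, step r g x y ≤ B := by
  have h : ∑ y, step r g x y = ∑ a, avg r x a * ∑ b, g a b := by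
    simp only [step_apply]
    rw [sum_comm]
    refine sum_congr rfl fun a _ => ?_
    rw [sum_comm, mul_sum]
    refine sum_congr rfl fun b _ => ?_
    rw [← mul_sum, sum_avg, mul_one]
  rw [h]
  calc ∑ a, avg r x a * ∑ b, g a b ≤ ∑ a, avg r x a * B :=
        sum_le_sum fun a _ => mul_le_mul_of_nonneg_left (hg a) (avg_nonneg _ _ _)
    _ = B := by rw [← sum_mul, sum_avg, one_mul]

lemma sum_step_col_le {r : Setoid V} {g : Matrix V V ℝ} {B : ℝ} (hg : ∀ y, ∑ x, g x y ≤ B)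
    (y : V) : ∑ x, step r g x y ≤ B := by
  have := sum_step_row_le (r := r) (g := gᵀ) (B := B) hg y
  rwa [← step_transpose] at this

/-- The entrywise inner product of two matrices. -/
def pairing (F G : Matrix V V ℝ) : ℝ := ∑ x, ∑ y, F x y * G x y

lemma pairing_eq_trace (F G : Matrix V V ℝ) : pairing F G = (Fᵀ * G).trace := by
  simp only [pairing, trace, diag_apply, mul_apply, transpose_apply]
  exact sum_comm

lemma pairing_step (r : Setoid V) (F G : Matrix V V ℝ) :
    pairing (step r F) G = pairing F (step r G) := by
  rw [pairing_eq_trace, pairing_eq_trace, step_transpose, step, step, Matrix.mul_assoc,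
    Matrix.mul_assoc, trace_mul_comm]
  simp only [Matrix.mul_assoc]

/-- The energy of a partition with respect to a matrix. -/
noncomputable def energy (r : Setoid V) (g : Matrix V V ℝ) : ℝ := pairing (step r g) (step r g)

lemma energy_nonneg (r : Setoid V) (g : Matrix V V ℝ) : 0 ≤ energy r g :=
  sum_nonneg fun _ _ => sum_nonneg fun _ _ => mul_self_nonneg _

lemma pairing_step_step {r s : Setoid V} (h : r ≤ s) (g : Matrix V V ℝ) :
    pairing (step r g) (step s g) = energy s g := by
  rw [pairing_step, step_step h, energy, pairing_step, step_step le_rfl]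

/-- Pythagoras: `r ≤ s` means that r refines s, and then averaging over s is an orthogonal
projection that factors through averaging over r. -/
lemma sum_sq_step_sub {r s : Setoid V} (h : r ≤ s) (g : Matrix V V ℝ) :
    ∑ x, ∑ y, (step r g x y - step s g x y) ^ 2 = energy r g - energy s g := by
  have h1 := pairing_step_step h g
  have : ∑ x, ∑ y, (step r g x y - step s g x y) ^ 2 =
      energy r g - 2 * pairing (step r g) (step s g) + energy s g := by
    simp only [energy, pairing, mul_sum, ← sum_sub_distrib, ← sum_add_distrib]
    exact sum_congr rfl fun x _ => sum_congr rfl fun y _ => by ring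
  rw [this, h1]
  ring

lemma energy_mono {r s : Setoid V} (h : r ≤ s) (g : Matrix V V ℝ) : energy s g ≤ energy r g := by
  have := sum_sq_step_sub h g
  have h0 : 0 ≤ ∑ x, ∑ y, (step r g x y - step s g x y) ^ 2 :=
    sum_nonneg fun _ _ => sum_nonneg fun _ _ => sq_nonneg _
  linarith

/-- `D` has cut norm at most `b`. -/
def CutLE (D : Matrix V V ℝ) (b : ℝ) : Prop :=
  ∀ u v : V → ℝ, (∀ x, u x ∈ Set.Icc (0 : ℝ) 1) → (∀ x, v x ∈ Set.Icc (0 : ℝ) 1) →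
    |u ⬝ᵥ (D *ᵥ v)| ≤ b

open scoped Classical in
/-- The indicator function of a set of vertices. -/
noncomputable def ind {U : Type*} (S : Set U) : U → ℝ := fun x => if x ∈ S then 1 else 0

lemma ind_mem {U : Type*} (S : Set U) (x : U) : ind S x ∈ Set.Icc (0 : ℝ) 1 := by
  unfold ind
  split_ifs <;> simp

/-- A linear functional on the cube attains its extremes at the indicators of the positive and of
the negative coordinates. Applied in each variable, this reduces the cut norm to sets. -/
lemma abs_dotProduct_le {h : V → ℝ} {b : ℝ} (H : ∀ S : Set V, |ind S ⬝ᵥ h| ≤ b) {u : V → ℝ}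
    (hu : ∀ x, u x ∈ Set.Icc (0 : ℝ) 1) : |u ⬝ᵥ h| ≤ b := by
  rw [abs_le]
  constructor
  · refine (abs_le.1 (H {x | h x < 0})).1.trans (sum_le_sum fun x _ => ?_)
    unfold ind
    by_cases hx : h x < 0
    · simp only [Set.mem_ofPred_eq, hx, if_true]
      nlinarith [(hu x).2]
    · simp only [Set.mem_ofPred_eq, hx, if_false, zero_mul]
      exact mul_nonneg (hu x).1 (not_lt.1 hx)
  · refine (sum_le_sum fun x _ => ?_).trans (abs_le.1 (H {x | 0 < h x})).2
    unfold ind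
    by_cases hx : 0 < h x
    · simp only [Set.mem_ofPred_eq, hx, if_true]
      nlinarith [(hu x).2]
    · simp only [Set.mem_ofPred_eq, hx, if_false, zero_mul]
      exact mul_nonpos_of_nonneg_of_nonpos (hu x).1 (not_lt.1 hx)

lemma cutLE_of_sets {D : Matrix V V ℝ} {b : ℝ}
    (H : ∀ S T : Set V, |ind S ⬝ᵥ (D *ᵥ ind T)| ≤ b) : CutLE D b := by
  intro u v hu hv
  rw [dotProduct_mulVec, dotProduct_comm]
  refine abs_dotProduct_le (fun T => ?_) hv
  rw [dotProduct_comm, ← dotProduct_mulVec]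
  exact abs_dotProduct_le (fun S => H S T) hu

lemma CutLE.apply_le {D : Matrix V V ℝ} {b : ℝ} (H : CutLE D b) {B C : ℝ} (hB : 0 < B)
    (hC : 0 < C) {u v : V → ℝ} (hu : ∀ x, u x ∈ Set.Icc (0 : ℝ) B)
    (hv : ∀ x, v x ∈ Set.Icc (0 : ℝ) C) : |u ⬝ᵥ (D *ᵥ v)| ≤ B * C * b := by
  have := H (B⁻¹ • u) (C⁻¹ • v)
    (fun x => ⟨mul_nonneg (inv_pos.2 hB).le (hu x).1, by
      simpa [inv_mul_le_iff₀ hB] using (hu x).2⟩)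
    (fun x => ⟨mul_nonneg (inv_pos.2 hC).le (hv x).1, by
      simpa [inv_mul_le_iff₀ hC] using (hv x).2⟩)
  rw [mulVec_smul, dotProduct_smul, smul_dotProduct, smul_eq_mul, smul_eq_mul, abs_mul, abs_mul,
    abs_of_pos (inv_pos.2 hB), abs_of_pos (inv_pos.2 hC), ← mul_assoc, ← mul_inv,
    inv_mul_le_iff₀ (by positivity)] at this
  rw [mul_comm B C]
  exact this

end SparseRemoval

/-! ### Weak and strong regularity with control of class sizes. -/

namespace SparseRemoval

open Finset Matrix

variable {V : Type*} [Fintype V]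

/-- The refinement of `r` by the set `T`. -/
def split {U : Type*} (r : Setoid U) (T : Set U) : Setoid U where
  r x y := r x y ∧ (x ∈ T ↔ y ∈ T)
  iseqv := ⟨fun x => ⟨r.refl x, Iff.rfl⟩, fun h => ⟨r.symm h.1, h.2.symm⟩,
    fun h h' => ⟨r.trans h.1 h'.1, h.2.trans h'.2⟩⟩

lemma split_le {U : Type*} (r : Setoid U) (T : Set U) : split r T ≤ r := fun _ _ h => h.1

lemma ind_eq_of_iff {U : Type*} {T : Set U} {x y : U} (h : x ∈ T ↔ y ∈ T) :
    ind T x = ind T y := by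
  by_cases hy : y ∈ T <;> simp [ind, h, hy]

lemma cellCard_split (r : Setoid V) (T : Set V) (x : V) :
    cellCard (split r T) x =
      cellCard r x * ∑ y, avg r x y * (1 - |ind T x - ind T y|) := by
  classical
  have h : ∀ y, avg r x y * (1 - |ind T x - ind T y|) =
      (cellCard r x)⁻¹ * if split r T x y then 1 else 0 := by
    intro y
    have hs : split r T x y ↔ r x y ∧ (x ∈ T ↔ y ∈ T) := Iff.rfl
    simp only [hs]
    by_cases hr : r x y <;> by_cases hx : x ∈ T <;> by_cases hy : y ∈ T <;>
      simp [avg, ind, hr, hx, hy]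
  simp_rw [h]
  rw [← mul_sum, mul_inv_cancel_left₀ (cellCard_pos r x).ne', sum_boole]
  rfl

/-- Splitting by S itself could create tiny classes. In a class where S has share below θ, T is
empty; where the complement has share below θ, T is everything; elsewhere T agrees with S. Every
piece then keeps a share of at least θ, and at most a θ-fraction of each class changes. -/
lemma exists_round (r : Setoid V) (S : Set V) {θ : ℝ} (hθ : 0 < θ) (hθ' : θ ≤ 1 / 2) :
    ∃ T : Set V, ∑ x, |ind S x - ind T x| ≤ θ * Fintype.card V ∧
      ∀ x, θ * cellCard r x ≤ cellCard (split r T) x := by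
  classical
  set α : V → ℝ := fun x => ∑ y, avg r x y * ind S y with hα
  have hαc : ∀ {x y}, r x y → α x = α y := fun {x y} h => by
    simp only [hα, avg_congr h]
  set T : Set V := {x | θ ≤ α x ∧ (1 - α x < θ ∨ x ∈ S)} with hT
  have memT : ∀ x, x ∈ T ↔ θ ≤ α x ∧ (1 - α x < θ ∨ x ∈ S) := fun x => Iff.rfl
  have hα1 : ∀ x, ∑ y, avg r x y * (1 - ind S y) = 1 - α x := by
    intro x
    simp only [mul_sub, mul_one, sum_sub_distrib, sum_avg, hα]
  have congr_cell : ∀ (x : V) (f f' : V → ℝ), (∀ y, r x y → f y = f' y) →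
      ∑ y, avg r x y * f y = ∑ y, avg r x y * f' y := by
    intro x f f' h
    refine sum_congr rfl fun y _ => ?_
    by_cases hy : r x y
    · rw [h y hy]
    · simp [avg, hy]
  refine ⟨T, ?_, fun x => ?_⟩
  · have key : ∀ x, ∑ y, avg r x y * |ind S y - ind T y| ≤ θ := by
      intro x
      by_cases h1 : θ ≤ α x
      · by_cases h2 : 1 - α x < θ
        · rw [congr_cell x _ (fun y => 1 - ind S y), hα1]
          · exact h2.le
          · intro y hy
            have : y ∈ T := by rw [memT, ← hαc hy]; exact ⟨h1, Or.inl h2⟩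
            by_cases hS : y ∈ S <;> simp [ind, this, hS]
        · rw [congr_cell x _ (fun y => 0)]
          · simpa using hθ.le
          · intro y hy
            have : y ∈ T ↔ y ∈ S := by rw [memT, ← hαc hy]; simp [h1, h2]
            simp [ind, this]
      · rw [congr_cell x _ (fun y => ind S y)]
        · exact (not_le.1 h1).le
        · intro y hy
          have : y ∉ T := by rw [memT, ← hαc hy]; simp [h1]
          by_cases hS : y ∈ S <;> simp [ind, this, hS]
    calc ∑ x, |ind S x - ind T x| = ∑ x, ∑ y, avg r x y * |ind S y - ind T y| := by
          rw [sum_comm]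
          simp_rw [← sum_mul, sum_avg_left, one_mul]
      _ ≤ ∑ _x : V, θ := sum_le_sum fun x _ => key x
      _ = θ * Fintype.card V := by simp [mul_comm]
  · rw [cellCard_split, mul_comm]
    refine mul_le_mul_of_nonneg_left ?_ (cellCard_pos r x).le
    by_cases h1 : θ ≤ α x
    · by_cases h2 : 1 - α x < θ
      · rw [congr_cell x _ (fun y => 1)]
        · simp only [mul_one, sum_avg]; linarith
        · intro y hy
          have hy' : y ∈ T := by rw [memT, ← hαc hy]; exact ⟨h1, Or.inl h2⟩
          have hx' : x ∈ T := by rw [memT]; exact ⟨h1, Or.inl h2⟩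
          simp [ind, hx', hy']
      · have hiff : ∀ y, r x y → (y ∈ T ↔ y ∈ S) := by
          intro y hy
          rw [memT, ← hαc hy]; simp [h1, h2]
        have hx := hiff x (r.refl x)
        by_cases hS : x ∈ S
        · rw [congr_cell x _ (fun y => ind S y)]
          · exact h1
          · intro y hy
            by_cases hyS : y ∈ S <;> simp [ind, hx, hS, hyS, hiff y hy]
        · rw [congr_cell x _ (fun y => 1 - ind S y), hα1]
          · exact not_lt.1 h2
          · intro y hy
            by_cases hyS : y ∈ S <;> simp [ind, hx, hS, hyS, hiff y hy]
    · rw [congr_cell x _ (fun y => 1)]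
      · simp only [mul_one, sum_avg]; linarith
      · intro y hy
        have hy' : y ∉ T := by rw [memT, ← hαc hy]; simp [h1]
        have hx' : x ∉ T := by rw [memT]; simp [h1]
        simp [ind, hx', hy']

lemma dotProduct_mulVec_eq_pairing (u v : V → ℝ) (D : Matrix V V ℝ) :
    u ⬝ᵥ (D *ᵥ v) = pairing D (fun x y => u x * v y) := by
  simp only [dotProduct, mulVec, pairing, mul_sum]
  exact sum_congr rfl fun x _ => sum_congr rfl fun y _ => by ring

lemma pairing_step_of_const {r : Setoid V} {g F : Matrix V V ℝ}
    (hF : ∀ x x' y y', r x x' → r y y' → F x y = F x' y') :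
    pairing (step r g) F = pairing g F := by
  rw [pairing_step, step_of_const hF]

lemma abs_dotProduct_le_sum_abs {u h : V → ℝ} {b : ℝ} (hb : ∀ x, |h x| ≤ b) :
    |u ⬝ᵥ h| ≤ (∑ x, |u x|) * b := by
  rw [sum_mul]
  refine (abs_sum_le_sum_abs _ _).trans (sum_le_sum fun x _ => ?_)
  rw [abs_mul]
  exact mul_le_mul_of_nonneg_left (hb x) (abs_nonneg _)

lemma abs_mulVec_le {D : Matrix V V ℝ} {b : ℝ} (hD : ∀ x, ∑ y, |D x y| ≤ b) {v : V → ℝ}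
    (hv : ∀ x, v x ∈ Set.Icc (0 : ℝ) 1) (x : V) : |(D *ᵥ v) x| ≤ b := by
  refine (abs_sum_le_sum_abs _ _).trans ((sum_le_sum fun y _ => ?_).trans (hD x))
  rw [abs_mul, abs_of_nonneg (hv y).1]
  exact mul_le_of_le_one_right (abs_nonneg _) (hv y).2

lemma sum_abs_sub_step_le {r : Setoid V} {g : Matrix V V ℝ} (hg : ∀ x y, 0 ≤ g x y) {B : ℝ}
    (hB : ∀ x, ∑ y, g x y ≤ B) (x : V) : ∑ y, |(g - step r g) x y| ≤ 2 * B := by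
  calc ∑ y, |(g - step r g) x y| ≤ ∑ y, (g x y + step r g x y) := by
        refine sum_le_sum fun y _ => ?_
        rw [Matrix.sub_apply, abs_le]
        have := hg x y
        have := step_nonneg (r := r) hg x y
        constructor <;> linarith
    _ ≤ 2 * B := by
        rw [sum_add_distrib]
        linarith [hB x, sum_step_row_le (r := r) hB x]

lemma pairing_sq_le (D F : Matrix V V ℝ) : pairing D F ^ 2 ≤ pairing D D * pairing F F := by
  have := sum_mul_sq_le_sq_mul_sq (univ : Finset (V × V)) (fun p => D p.1 p.2)
    (fun p => F p.1 p.2)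
  simpa only [pairing, ← univ_product_univ, sum_product, sq] using this

/-- Either a partition is regular or some refinement, whose classes are not much smaller, has
larger energy. -/
lemma exists_energy_increment {g : Matrix V V ℝ} (hg : ∀ x y, 0 ≤ g x y) {K : ℝ}
    (hrow : ∀ x, ∑ y, g x y ≤ K * Fintype.card V) (hcol : ∀ y, ∑ x, g x y ≤ K * Fintype.card V)
    (r : Setoid V) {ε θ : ℝ} (hε : 0 < ε) (hθ : 0 < θ) (hθ' : θ ≤ 1 / 2)
    (hθK : 4 * θ * K ≤ ε / 2) :
    CutLE (g - step r g) (ε * Fintype.card V ^ 2) ∨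
      ∃ s ≤ r, (∀ x, θ ^ 2 * cellCard r x ≤ cellCard s x) ∧
        energy r g + (ε / 2) ^ 2 * Fintype.card V ^ 2 ≤ energy s g := by
  rw [or_iff_not_imp_left]
  intro hcut
  set N : ℝ := (Fintype.card V : ℝ) with hN
  have hN0 : 0 ≤ N := by positivity
  set D := g - step r g with hD
  obtain ⟨S, T, hST⟩ : ∃ S T : Set V, ε * N ^ 2 < |ind S ⬝ᵥ (D *ᵥ ind T)| := by
    by_contra! h
    exact hcut (cutLE_of_sets h)
  obtain ⟨S', hS', hrS⟩ := exists_round r S hθ hθ'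
  -- T is rounded relative to the partition already split by S', so the two splittings together cost
  -- a factor θ² in class size.
  obtain ⟨T', hT', hrT⟩ := exists_round (split r S') T hθ hθ'
  set s := split (split r S') T' with hs
  have hsr : s ≤ r := (split_le _ _).trans (split_le _ _)
  have hDrow : ∀ x, ∑ y, |D x y| ≤ 2 * (K * N) := sum_abs_sub_step_le hg hrow
  have hDcol : ∀ x, ∑ y, |Dᵀ x y| ≤ 2 * (K * N) := by
    intro x
    have := sum_abs_sub_step_le (r := r) (g := gᵀ) (fun x y => hg y x) hcol x
    rwa [← step_transpose, ← transpose_sub] at this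
  have e1 : |(ind S - ind S') ⬝ᵥ (D *ᵥ ind T)| ≤ θ * N * (2 * (K * N)) := by
    have h := abs_dotProduct_le_sum_abs (u := ind S - ind S') (abs_mulVec_le hDrow (ind_mem T))
    cases isEmpty_or_nonempty V
    · simp [hN]
    · refine h.trans (mul_le_mul_of_nonneg_right hS' ?_)
      exact (sum_nonneg fun _ _ => abs_nonneg _).trans (hDrow (Classical.arbitrary V))
  have e2 : |ind S' ⬝ᵥ (D *ᵥ (ind T - ind T'))| ≤ θ * N * (2 * (K * N)) := by
    have h := abs_dotProduct_le_sum_abs (u := ind T - ind T') (abs_mulVec_le hDcol (ind_mem S'))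
    rw [mulVec_transpose, dotProduct_comm, ← dotProduct_mulVec] at h
    cases isEmpty_or_nonempty V
    · simp [hN]
    · refine h.trans (mul_le_mul_of_nonneg_right hT' ?_)
      exact (sum_nonneg fun _ _ => abs_nonneg _).trans (hDrow (Classical.arbitrary V))
  have e3 : ind S ⬝ᵥ (D *ᵥ ind T) = (ind S - ind S') ⬝ᵥ (D *ᵥ ind T) +
      ind S' ⬝ᵥ (D *ᵥ (ind T - ind T')) + ind S' ⬝ᵥ (D *ᵥ ind T') := by
    rw [mulVec_sub, dotProduct_sub, sub_dotProduct]
    ring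
  -- The rows and columns of D have ℓ¹-norm at most 2KN, so each rounding costs at most 2θKN²; `hθK`
  -- makes the sum at most half of the cut discrepancy.
  have e4 : ε / 2 * N ^ 2 ≤ |ind S' ⬝ᵥ (D *ᵥ ind T')| := by
    have h1 := abs_add_le ((ind S - ind S') ⬝ᵥ (D *ᵥ ind T) +
      ind S' ⬝ᵥ (D *ᵥ (ind T - ind T'))) (ind S' ⬝ᵥ (D *ᵥ ind T'))
    have h2 := abs_add_le ((ind S - ind S') ⬝ᵥ (D *ᵥ ind T))
      (ind S' ⬝ᵥ (D *ᵥ (ind T - ind T')))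
    rw [← e3] at h1
    nlinarith [mul_le_mul_of_nonneg_right hθK (sq_nonneg N)]
  set F : Matrix V V ℝ := fun x y => ind S' x * ind T' y with hF
  have hFc : ∀ x x' y y', s x x' → s y y' → F x y = F x' y' := by
    intro x x' y y' hx hy
    simp only [hF]
    rw [ind_eq_of_iff hx.1.2, ind_eq_of_iff hy.2]
  have e5 : ind S' ⬝ᵥ (D *ᵥ ind T') = pairing (step s g - step r g) F := by
    rw [dotProduct_mulVec_eq_pairing]
    have := pairing_step_of_const (g := g) hFc
    simp only [pairing, hD, Matrix.sub_apply, sub_mul, sum_sub_distrib] at this ⊢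
    rw [this]
  have e6 : pairing F F ≤ N ^ 2 := by
    calc pairing F F ≤ ∑ _x : V, ∑ _y : V, (1 : ℝ) := by
          refine sum_le_sum fun x _ => sum_le_sum fun y _ => ?_
          have h1 := ind_mem S' x
          have h2 := ind_mem T' y
          have h3 : 0 ≤ F x y := mul_nonneg h1.1 h2.1
          have h4 : F x y ≤ 1 := mul_le_one₀ h1.2 h2.1 h2.2
          exact mul_le_one₀ h4 h3 h4
      _ = N ^ 2 := by simp [hN, sq]
  have e7 := pairing_sq_le (step s g - step r g) F
  have e8 : pairing (step s g - step r g) (step s g - step r g) = energy s g - energy r g := by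
    rw [← sum_sq_step_sub hsr]
    simp [pairing, sq]
  rw [e8, ← e5, ← sq_abs] at e7
  have e9 : 0 ≤ energy s g - energy r g := by linarith [energy_mono hsr g]
  refine ⟨s, hsr, fun x => ?_, ?_⟩
  · have := mul_le_mul_of_nonneg_left (hrS x) hθ.le
    have := hrT x
    nlinarith
  · have e10 : (ε / 2 * N ^ 2) ^ 2 ≤ (energy s g - energy r g) * N ^ 2 :=
      (pow_le_pow_left₀ (by positivity) e4 2).trans
        (e7.trans (mul_le_mul_of_nonneg_left e6 e9))
    rcases hN0.eq_or_lt with h0 | h0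
    · rw [← h0]
      linarith
    · have h0' : 0 < N ^ 2 := by positivity
      have : (ε / 2) ^ 2 * N ^ 2 ≤ energy s g - energy r g := by
        refine le_of_mul_le_mul_right ?_ h0'
        linarith
      linarith

/-- All classes of `r` have at least `τ * |V|` elements. -/
def LargeCells (r : Setoid V) (τ : ℝ) : Prop := ∀ x, τ * Fintype.card V ≤ cellCard r x

universe u

/-- A weak regularity lemma with a lower bound for the sizes of the classes. -/
theorem exists_cutLE (K C : ℝ) {ε τ : ℝ} (hε : 0 < ε) (hτ : 0 < τ) :
    ∃ τ' : ℝ, 0 < τ' ∧ τ' ≤ τ ∧ ∀ (V : Type u) [Fintype V] [Nonempty V] (g : Matrix V V ℝ),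
      (∀ x y, 0 ≤ g x y) → (∀ x, ∑ y, g x y ≤ K * Fintype.card V) →
      (∀ y, ∑ x, g x y ≤ K * Fintype.card V) →
      (∀ r : Setoid V, LargeCells r τ' → energy r g ≤ C * Fintype.card V ^ 2) →
      ∀ r : Setoid V, LargeCells r τ → ∃ s ≤ r, LargeCells s τ' ∧
        CutLE (g - step s g) (ε * Fintype.card V ^ 2) := by
  obtain ⟨θ, hθ, hθ', hθK⟩ : ∃ θ : ℝ, 0 < θ ∧ θ ≤ 1 / 2 ∧ 4 * θ * K ≤ ε / 2 := by
    refine ⟨min (1 / 2) (ε / (8 * (|K| + 1))), by positivity, min_le_left _ _, ?_⟩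
    have h1 : min (1 / 2) (ε / (8 * (|K| + 1))) ≤ ε / (8 * (|K| + 1)) := min_le_right _ _
    have h2 : (0 : ℝ) < min (1 / 2) (ε / (8 * (|K| + 1))) := by positivity
    rw [le_div_iff₀ (by positivity)] at h1
    nlinarith [le_abs_self K]
  -- J bounds the number of energy increments. Each shrinks the classes by at most θ², so all
  -- partitions met have relative class size at least τ θ^(2J); only for these is the energy bound
  -- needed, and for very fine partitions of a sparse graph it can fail.
  obtain ⟨J, hJ⟩ := exists_nat_gt (C / (ε / 2) ^ 2)
  rw [div_lt_iff₀ (by positivity)] at hJ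
  have hρ : θ ^ 2 ≤ 1 := by nlinarith
  have hle : ∀ j, j ≤ J → τ * (θ ^ 2) ^ J ≤ τ * (θ ^ 2) ^ j := fun j hj =>
    mul_le_mul_of_nonneg_left (pow_le_pow_of_le_one (by positivity) hρ hj) hτ.le
  refine ⟨τ * (θ ^ 2) ^ J, by positivity, by simpa using hle 0 (Nat.zero_le _), ?_⟩
  intro V _ _ g hg hrow hcol hen r hr
  have hN : (0 : ℝ) < Fintype.card V := by exact_mod_cast Fintype.card_pos
  have mono : ∀ {s : Setoid V} {j : ℕ}, j ≤ J → LargeCells s (τ * (θ ^ 2) ^ j) →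
      LargeCells s (τ * (θ ^ 2) ^ J) := fun hj hs x =>
    (mul_le_mul_of_nonneg_right (hle _ hj) hN.le).trans (hs x)
  by_contra hno
  have key : ∀ j ≤ J, ∃ s ≤ r, LargeCells s (τ * (θ ^ 2) ^ j) ∧
      j * ((ε / 2) ^ 2 * Fintype.card V ^ 2) ≤ energy s g := by
    intro j
    induction j with
    | zero => exact fun _ => ⟨r, le_rfl, by simpa using hr, by simpa using energy_nonneg r g⟩
    | succ j ih =>
      intro hj
      obtain ⟨s, hs, hls, hes⟩ := ih (by omega)
      rcases exists_energy_increment hg hrow hcol s hε hθ hθ' hθK with h | ⟨s', hs', hc, he⟩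
      · exact absurd ⟨s, hs, mono (by omega) hls, h⟩ hno
      · refine ⟨s', hs'.trans hs, fun x => ?_, by push_cast; linarith⟩
        have := mul_le_mul_of_nonneg_left (hls x) (sq_nonneg θ)
        have := hc x
        rw [pow_succ]
        linarith
  obtain ⟨s, hs, hls, hes⟩ := key J le_rfl
  have := hen s hls
  have hN2 : (0 : ℝ) < Fintype.card V ^ 2 := by positivity
  nlinarith

/-- A strong regularity lemma, with three successive partitions. -/
theorem exists_strong_regular (K C : ℝ) {η : ℝ} (hη : 0 < η) {e : ℝ → ℝ}
    (he : ∀ t, 0 < t → 0 < e t) :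
    ∃ τ₀ : ℝ, 0 < τ₀ ∧ ∀ (V : Type u) [Fintype V] [Nonempty V] (g : Matrix V V ℝ),
      (∀ x y, 0 ≤ g x y) → (∀ x, ∑ y, g x y ≤ K * Fintype.card V) →
      (∀ y, ∑ x, g x y ≤ K * Fintype.card V) →
      (∀ r : Setoid V, LargeCells r τ₀ → energy r g ≤ C * Fintype.card V ^ 2) →
      ∃ (τ τ₁ : ℝ) (P Q₁ Q₂ : Setoid V), τ₀ ≤ τ₁ ∧ τ₁ ≤ τ ∧ τ ≤ 1 ∧ Q₁ ≤ P ∧ Q₂ ≤ Q₁ ∧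
        LargeCells P τ ∧ LargeCells Q₁ τ₁ ∧ LargeCells Q₂ τ₀ ∧
        CutLE (g - step Q₁ g) (e τ * Fintype.card V ^ 2) ∧
        CutLE (g - step Q₂ g) (e τ₁ * Fintype.card V ^ 2) ∧
        energy Q₂ g - energy P g ≤ η * Fintype.card V ^ 2 := by
  -- The class size function of weak regularity is made total, with an irrelevant value for t ≤ 0,
  -- so that it can be iterated from 1.
  have hφ : ∀ t : ℝ, ∃ t' : ℝ, 0 < t → 0 < t' ∧ t' ≤ t ∧
      ∀ (V : Type u) [Fintype V] [Nonempty V] (g : Matrix V V ℝ),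
      (∀ x y, 0 ≤ g x y) → (∀ x, ∑ y, g x y ≤ K * Fintype.card V) →
      (∀ y, ∑ x, g x y ≤ K * Fintype.card V) →
      (∀ r : Setoid V, LargeCells r t' → energy r g ≤ C * Fintype.card V ^ 2) →
      ∀ r : Setoid V, LargeCells r t → ∃ s ≤ r, LargeCells s t' ∧
        CutLE (g - step s g) (e t * Fintype.card V ^ 2) := by
    intro t
    by_cases ht : 0 < t
    · obtain ⟨t', h⟩ := exists_cutLE.{u} K C (he t ht) ht
      exact ⟨t', fun _ => h⟩
    · exact ⟨0, fun h => absurd h ht⟩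
  choose φ hφ using hφ
  set t : ℕ → ℝ := fun i => φ^[i] 1 with ht
  have tsucc : ∀ i, t (i + 1) = φ (t i) := fun i => Function.iterate_succ_apply' φ i 1
  have tpos : ∀ i, 0 < t i := by
    intro i
    induction i with
    | zero => simp [ht]
    | succ i ih => rw [tsucc]; exact (hφ _ ih).1
  have tanti : Antitone t := antitone_nat_of_succ_le fun i => by
    rw [tsucc]; exact (hφ _ (tpos i)).2.1
  obtain ⟨J, hJ⟩ := exists_nat_gt (C / η)
  rw [div_lt_iff₀ hη] at hJ
  refine ⟨t (2 * J), tpos _, ?_⟩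
  intro V _ _ g hg hrow hcol hen
  have hN : (0 : ℝ) < Fintype.card V := by exact_mod_cast Fintype.card_pos
  have mono : ∀ {s : Setoid V} {i j : ℕ}, i ≤ j → LargeCells s (t i) → LargeCells s (t j) :=
    fun hij hs x => (mul_le_mul_of_nonneg_right (tanti hij) hN.le).trans (hs x)
  have weak : ∀ i, i + 1 ≤ 2 * J → ∀ r : Setoid V, LargeCells r (t i) →
      ∃ s ≤ r, LargeCells s (t (i + 1)) ∧
        CutLE (g - step s g) (e (t i) * Fintype.card V ^ 2) := by
    intro i hi r hr
    rw [tsucc]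
    refine (hφ _ (tpos i)).2.2 V g hg hrow hcol (fun r hr => hen r ?_) r hr
    rw [← tsucc] at hr
    exact mono hi hr
  by_contra hno
  -- From the trivial partition, each round refines twice. If the two refinements together gain at
  -- most η N², they are the required Q₁ and Q₂; otherwise the energy grows, and this cannot happen
  -- J > C/η times.
  have key : ∀ j ≤ J, ∃ s : Setoid V, LargeCells s (t (2 * j)) ∧
      j * (η * Fintype.card V ^ 2) ≤ energy s g := by
    intro j
    induction j with
    | zero =>
      refine fun _ => ⟨⊤, fun x => ?_, by simpa using energy_nonneg _ g⟩
      simp [ht, cellCard]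
    | succ j ih =>
      intro hj
      obtain ⟨P, hP, heP⟩ := ih (by omega)
      obtain ⟨Q₁, hQ₁, hl₁, hc₁⟩ := weak (2 * j) (by omega) P hP
      obtain ⟨Q₂, hQ₂, hl₂, hc₂⟩ := weak (2 * j + 1) (by omega) Q₁ hl₁
      by_cases hd : energy Q₂ g - energy P g ≤ η * Fintype.card V ^ 2
      · exact absurd ⟨t (2 * j), t (2 * j + 1), P, Q₁, Q₂, tanti (by omega), tanti (by omega),
          tanti (Nat.zero_le _), hQ₁, hQ₂, hP, hl₁, mono (by omega) hl₂, hc₁, hc₂, hd⟩ hno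
      · exact ⟨Q₂, hl₂, by push_cast; linarith⟩
  obtain ⟨s, hls, hes⟩ := key J le_rfl
  have := hen s hls
  have hN2 : (0 : ℝ) < Fintype.card V ^ 2 := by positivity
  nlinarith

end SparseRemoval

/-! ### Consequences of having few rectangles. -/

namespace SparseRemoval

open Finset Matrix

variable {V : Type*} [Fintype V]

open scoped Classical in
/-- The number of nondegenerate pairs of common neighbours of `b` and `b'`. -/
noncomputable def rectPair (A : Matrix V V ℝ) (b b' : V) : ℝ :=
  ∑ a, ∑ a', if a ≠ a' ∧ b ≠ b' then A a b * A a b' * (A a' b * A a' b') else 0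

/-- The number of nondegenerate rectangles in a `0/1`-matrix. -/
noncomputable def rectSum (A : Matrix V V ℝ) : ℝ := ∑ b, ∑ b', rectPair A b b'

/-- The number of closed walks of length five, with a base point. -/
def pentSum (A : Matrix V V ℝ) : ℝ :=
  ∑ a, ∑ b, ∑ c, ∑ d, ∑ e, A a b * A b c * A c d * A d e * A e a

lemma rectSum_transpose (A : Matrix V V ℝ) : rectSum Aᵀ = rectSum A := by
  classical
  have h : ∀ B : Matrix V V ℝ, rectSum B = ∑ p : V × V, ∑ q : V × V,
      if q.1 ≠ q.2 ∧ p.1 ≠ p.2 then B q.1 p.1 * B q.1 p.2 * (B q.2 p.1 * B q.2 p.2) else 0 := by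
    intro B
    simp only [rectSum, rectPair, ← univ_product_univ, sum_product]
  rw [h, h, sum_comm]
  refine sum_congr rfl fun p _ => sum_congr rfl fun q _ => ?_
  simp only [transpose_apply, and_comm (a := q.1 ≠ q.2)]
  congr 1
  ring

variable {A : Matrix V V ℝ}

lemma nonneg_of_zero_one {U : Type*} {A : Matrix U U ℝ} (hA : ∀ x y, A x y = 0 ∨ A x y = 1)
    (x y : U) : 0 ≤ A x y := by
  rcases hA x y with h | h <;> simp [h]

lemma le_one_of_zero_one {U : Type*} {A : Matrix U U ℝ} (hA : ∀ x y, A x y = 0 ∨ A x y = 1)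
    (x y : U) : A x y ≤ 1 := by
  rcases hA x y with h | h <;> simp [h]

lemma mul_self_of_zero_one {U : Type*} {A : Matrix U U ℝ} (hA : ∀ x y, A x y = 0 ∨ A x y = 1)
    (x y : U) :
    A x y * A x y = A x y := by
  rcases hA x y with h | h <;> simp [h]

lemma rectPair_nonneg (hA : ∀ x y, A x y = 0 ∨ A x y = 1) (b b' : V) : 0 ≤ rectPair A b b' := by
  refine sum_nonneg fun a _ => sum_nonneg fun a' _ => ?_
  have := nonneg_of_zero_one hA
  split_ifs
  · exact mul_nonneg (mul_nonneg (this _ _) (this _ _)) (mul_nonneg (this _ _) (this _ _))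
  · rfl

lemma rectPair_eq (hA : ∀ x y, A x y = 0 ∨ A x y = 1) {b b' : V} (h : b ≠ b') :
    rectPair A b b' = (Aᵀ * A) b b' ^ 2 - (Aᵀ * A) b b' := by
  classical
  have hX : ∀ a, A a b * A a b' * (A a b * A a b') = A a b * A a b' := by
    intro a
    rw [mul_mul_mul_comm, mul_self_of_zero_one hA, mul_self_of_zero_one hA]
  simp only [mul_apply, transpose_apply, sq, sum_mul_sum, rectPair, ← sum_sub_distrib]
  refine sum_congr rfl fun a _ => ?_
  have : A a b * A a b' =
      ∑ a', if a = a' then A a b * A a b' * (A a' b * A a' b') else 0 := by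
    rw [sum_ite_eq, if_pos (mem_univ _), hX]
  conv_rhs => arg 2; rw [this]
  rw [← sum_sub_distrib]
  refine sum_congr rfl fun a' _ => ?_
  by_cases ha : a = a' <;> simp [ha, h]

/-- With c the codegree, the pairs of distinct common neighbours number c² − c, and c ≤ 1 + (c² − c)
is (c − 1)² ≥ 0. -/
lemma codegree_le (hA : ∀ x y, A x y = 0 ∨ A x y = 1) {b b' : V} (h : b ≠ b') :
    (Aᵀ * A) b b' ≤ 1 + rectPair A b b' := by
  rw [rectPair_eq hA h]
  nlinarith [sq_nonneg ((Aᵀ * A) b b' - 1)]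

lemma codegree_sq_le (hA : ∀ x y, A x y = 0 ∨ A x y = 1) {b b' : V} (h : b ≠ b') :
    (Aᵀ * A) b b' ^ 2 ≤ 1 + 2 * rectPair A b b' := by
  rw [rectPair_eq hA h]
  nlinarith [sq_nonneg ((Aᵀ * A) b b' - 1)]

lemma codegree_self (hA : ∀ x y, A x y = 0 ∨ A x y = 1) (b : V) :
    (Aᵀ * A) b b = ∑ a, A a b := by
  simp only [mul_apply, transpose_apply, mul_self_of_zero_one hA]

lemma sum_sq_degree_le (hA : ∀ x y, A x y = 0 ∨ A x y = 1) :
    ∑ x, (∑ y, A x y) ^ 2 ≤ 2 * Fintype.card V ^ 2 + rectSum A := by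
  classical
  have h1 : ∑ x, (∑ y, A x y) ^ 2 = ∑ b, ∑ b', (Aᵀ * A) b b' := by
    simp only [sq, sum_mul_sum, mul_apply, transpose_apply]
    rw [sum_comm]
    refine sum_congr rfl fun b _ => sum_comm
  rw [h1]
  calc ∑ b, ∑ b', (Aᵀ * A) b b' ≤
      ∑ b, ∑ b', ((if b = b' then (Fintype.card V : ℝ) else 0) + 1 + rectPair A b b') := by
        refine sum_le_sum fun b _ => sum_le_sum fun b' _ => ?_
        have h0 := rectPair_nonneg hA b b'
        by_cases h : b = b'
        · subst h
          rw [codegree_self hA, if_pos rfl]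
          have : ∑ a, A a b ≤ ∑ _a : V, (1 : ℝ) :=
            sum_le_sum fun a _ => le_one_of_zero_one hA _ _
          simp at this
          linarith
        · rw [if_neg h]
          linarith [codegree_le hA h]
    _ = _ := by
        simp only [sum_add_distrib, sum_ite_eq, mem_univ, if_true, sum_const, card_univ,
          nsmul_eq_mul, rectSum]
        ring

/-- Averaging on the left contracts the L² norm, by Cauchy–Schwarz with the weights `avg r x`.
Keeping only the right average turns the energy into a weighted sum of codegrees. -/
lemma energy_le_pairing (r : Setoid V) (g : Matrix V V ℝ) :
    energy r g ≤ pairing (g * avg r) (g * avg r) := by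
  have key : ∀ x y, step r g x y * step r g x y ≤
      ∑ a, avg r x a * ((g * avg r) a y * (g * avg r) a y) := by
    intro x y
    have h := sum_sq_le_sum_mul_sum_of_sq_le_mul univ
      (r := fun a => avg r x a * (g * avg r) a y) (f := fun a => avg r x a)
      (g := fun a => avg r x a * ((g * avg r) a y * (g * avg r) a y))
      (fun a _ => avg_nonneg _ _ _)
      (fun a _ => mul_nonneg (avg_nonneg _ _ _) (mul_self_nonneg _))
      (fun a _ => le_of_eq (by ring))
    rw [sum_avg, one_mul, sq] at h
    rw [step, Matrix.mul_assoc]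
    exact h
  calc energy r g ≤ ∑ x, ∑ y, ∑ a, avg r x a * ((g * avg r) a y * (g * avg r) a y) :=
        sum_le_sum fun x _ => sum_le_sum fun y _ => key x y
    _ = ∑ a, ∑ y, ∑ x, avg r x a * ((g * avg r) a y * (g * avg r) a y) := by
        rw [sum_comm, sum_congr rfl fun y _ => sum_comm, sum_comm]
    _ = _ := by
        simp only [← sum_mul, sum_avg_left, one_mul, pairing]

lemma pairing_mul_avg (r : Setoid V) (g : Matrix V V ℝ) :
    pairing (g * avg r) (g * avg r) = ∑ b, ∑ b', (gᵀ * g) b b' * avg r b' b := by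
  rw [pairing_eq_trace, transpose_mul, avg_transpose, Matrix.mul_assoc, trace_mul_comm,
    ← Matrix.mul_assoc, Matrix.mul_assoc, avg_mul_avg le_rfl]
  simp only [trace, diag_apply, mul_apply]

/-- The three terms come from the diagonal (codegree equals degree), from the 1 in `codegree_le`,
and from rectangles, whose averaging weight is at most 1/(τN). -/
lemma energy_le {s K τ : ℝ} (hA : ∀ x y, A x y = 0 ∨ A x y = 1) (hs : s ^ 2 = Fintype.card V)
    (hcol : ∀ y, ∑ x, A x y ≤ K * s) (hτ : 0 < τ) [Nonempty V] {r : Setoid V}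
    (hr : LargeCells r τ) :
    energy r (s • A) ≤ Fintype.card V * (K * s / τ + Fintype.card V) + rectSum A / τ := by
  classical
  set N : ℝ := (Fintype.card V : ℝ) with hN
  have hN0 : 0 < N := by rw [hN]; exact_mod_cast Fintype.card_pos
  have hgg : (s • A)ᵀ * (s • A) = N • (Aᵀ * A) := by
    rw [transpose_smul, Matrix.smul_mul, Matrix.mul_smul, smul_smul, ← sq, hs]
  have hw : ∀ b b', avg r b' b ≤ (τ * N)⁻¹ := fun b b' => avg_le (by positivity) (hr b') b
  refine (energy_le_pairing r _).trans ?_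
  rw [pairing_mul_avg, hgg]
  simp only [Matrix.smul_apply, smul_eq_mul]
  calc ∑ b, ∑ b', N * (Aᵀ * A) b b' * avg r b' b ≤
      ∑ b, ∑ b', (N * ((if b = b' then K * s * (τ * N)⁻¹ else 0) + avg r b' b) +
        rectPair A b b' / τ) := by
        refine sum_le_sum fun b _ => sum_le_sum fun b' _ => ?_
        have h0 := rectPair_nonneg hA b b'
        have h1 := avg_nonneg r b' b
        have h2 := hw b b'
        have h3 : 0 ≤ rectPair A b b' / τ := by positivity
        rw [mul_assoc]
        by_cases h : b = b'
        · subst h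
          rw [codegree_self hA, if_pos rfl]
          have h4 : (∑ a, A a b) * avg r b b ≤ K * s * (τ * N)⁻¹ :=
            mul_le_mul (hcol b) h2 h1
              ((sum_nonneg fun a _ => nonneg_of_zero_one hA a b).trans (hcol b))
          nlinarith
        · rw [if_neg h, zero_add]
          have h4 := mul_le_mul_of_nonneg_right (codegree_le hA h) h1
          have h5 := mul_le_mul_of_nonneg_left h2 h0
          have h6 : N * (rectPair A b b' * (τ * N)⁻¹) = rectPair A b b' / τ := by
            field_simp
          nlinarith
    _ = _ := by
        simp only [sum_add_distrib, ← mul_sum, sum_ite_eq, mem_univ, if_true, sum_const, card_univ,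
          nsmul_eq_mul, rectSum, ← sum_div, sum_avg_left, ← hN, mul_one]
        field_simp

/-- Pairs of 2-walks with common ends and middles y, y' number the common in-neighbours of y, y'
times their common out-neighbours. AM–GM and `codegree_sq_le` bound this product by 1 plus the
rectangles on either side. -/
lemma sum_sq_mul_self_le {s K : ℝ} (hA : ∀ x y, A x y = 0 ∨ A x y = 1)
    (hs : s ^ 2 = Fintype.card V) (hrow : ∀ x, ∑ y, A x y ≤ K * s)
    (hcol : ∀ y, ∑ x, A x y ≤ K * s) :
    ∑ x, ∑ z, (A * A) x z ^ 2 ≤ (K ^ 2 + 1) * Fintype.card V ^ 2 + 2 * rectSum A := by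
  classical
  have hA' : ∀ x y, Aᵀ x y = 0 ∨ Aᵀ x y = 1 := fun x y => hA y x
  have h1 : ∑ x, ∑ z, (A * A) x z ^ 2 =
      ∑ y, ∑ y', (Aᵀ * A) y y' * (Aᵀᵀ * Aᵀ) y y' := by
    have : ∑ x, ∑ z, (A * A) x z ^ 2 = pairing (A * A) (A * A) := by simp [pairing, sq]
    rw [this, pairing_eq_trace, transpose_mul, Matrix.mul_assoc, trace_mul_comm,
      ← Matrix.mul_assoc, Matrix.mul_assoc]
    simp only [trace, diag_apply]
    refine sum_congr rfl fun y _ => ?_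
    rw [mul_apply]
    refine sum_congr rfl fun y' _ => ?_
    congr 1
    simp [mul_apply, transpose_apply, mul_comm]
  rw [h1]
  calc _ ≤ ∑ y, ∑ y', ((if y = y' then K ^ 2 * (Fintype.card V : ℝ) else 0) + 1 +
        rectPair A y y' + rectPair Aᵀ y y') := by
        refine sum_le_sum fun b _ => sum_le_sum fun b' _ => ?_
        have h0 := rectPair_nonneg hA b b'
        have h0' := rectPair_nonneg hA' b b'
        by_cases h : b = b'
        · subst h
          rw [codegree_self hA, codegree_self hA', if_pos rfl]
          have h2 := mul_le_mul (hcol b) (hrow b) (sum_nonneg fun a _ => nonneg_of_zero_one hA b a)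
            ((sum_nonneg fun a _ => nonneg_of_zero_one hA a b).trans (hcol b))
          simp only [transpose_apply]
          nlinarith
        · rw [if_neg h]
          nlinarith [codegree_sq_le hA h, codegree_sq_le hA' h,
            sq_nonneg ((Aᵀ * A) b b' - (Aᵀᵀ * Aᵀ) b b')]
    _ = (K ^ 2 + 1) * (Fintype.card V : ℝ) ^ 2 + rectSum A + rectSum Aᵀ := by
        simp only [sum_add_distrib, sum_ite_eq, mem_univ, if_true, sum_const, card_univ,
          nsmul_eq_mul, rectSum]
        ring
    _ = _ := by rw [rectSum_transpose]; ring

end SparseRemoval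

/-! ### Walks of length four under cut-norm approximation. -/

namespace SparseRemoval

open Finset Matrix

variable {V : Type*} [Fintype V]

/-- A nonnegative matrix whose row sums are at most `B`. -/
def RowLE (M : Matrix V V ℝ) (B : ℝ) : Prop := (∀ x y, 0 ≤ M x y) ∧ ∀ x, ∑ y, M x y ≤ B

lemma RowLE.mul {M M' : Matrix V V ℝ} {B B' : ℝ} (h : RowLE M B) (h' : RowLE M' B')
    (hB' : 0 ≤ B') : RowLE (M * M') (B * B') := by
  refine ⟨fun x y => sum_nonneg fun z _ => mul_nonneg (h.1 _ _) (h'.1 _ _), fun x => ?_⟩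
  simp only [mul_apply]
  rw [sum_comm]
  calc ∑ z, ∑ y, M x z * M' z y ≤ ∑ z, M x z * B' := by
        refine sum_le_sum fun z _ => ?_
        rw [← mul_sum]
        exact mul_le_mul_of_nonneg_left (h'.2 z) (h.1 _ _)
    _ ≤ B * B' := by
        rw [← sum_mul]
        exact mul_le_mul_of_nonneg_right (h.2 x) hB'

lemma RowLE.mulVec_mem {M : Matrix V V ℝ} {B : ℝ} (h : RowLE M B) {v : V → ℝ}
    (hv : ∀ x, v x ∈ Set.Icc (0 : ℝ) 1) (x : V) : (M *ᵥ v) x ∈ Set.Icc (0 : ℝ) B :=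
  ⟨sum_nonneg fun y _ => mul_nonneg (h.1 _ _) (hv y).1,
    (sum_le_sum fun y _ => mul_le_of_le_one_right (h.1 _ _) (hv y).2).trans (h.2 x)⟩

/-- The outer factors are absorbed into the test functions, which stay nonnegative and become
bounded by B and B'. -/
lemma CutLE.mul {D M M' : Matrix V V ℝ} {b B B' : ℝ} (h : CutLE D b) (hM : RowLE Mᵀ B)
    (hM' : RowLE M' B') (hB : 0 < B) (hB' : 0 < B') : CutLE (M * D * M') (B * B' * b) := by
  intro u v hu hv
  rw [← mulVec_mulVec, ← mulVec_mulVec, dotProduct_mulVec, ← mulVec_transpose]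
  exact h.apply_le hB hB' (hM.mulVec_mem hu) (hM'.mulVec_mem hv)

lemma CutLE.add {D D' : Matrix V V ℝ} {b b' : ℝ} (h : CutLE D b) (h' : CutLE D' b') :
    CutLE (D + D') (b + b') := by
  intro u v hu hv
  rw [add_mulVec, dotProduct_add]
  exact (abs_add_le _ _).trans (add_le_add (h u v hu hv) (h' u v hu hv))

/-- Multiplication of the columns of `M` by the weights `u`. -/
def scaleCols {U : Type*} (M : Matrix U U ℝ) (u : U → ℝ) : Matrix U U ℝ := fun x y => M x y * u y

lemma RowLE.scaleCols {M : Matrix V V ℝ} {B : ℝ} (h : RowLE M B) {u : V → ℝ}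
    (hu : ∀ x, u x ∈ Set.Icc (0 : ℝ) 1) : RowLE (scaleCols M u) B :=
  ⟨fun _ y => mul_nonneg (h.1 _ _) (hu y).1,
    fun _ => (sum_le_sum fun y _ => mul_le_of_le_one_right (h.1 _ _) (hu y).2).trans (h.2 _)⟩

lemma RowLE.scaleCols_transpose {M : Matrix V V ℝ} {B : ℝ} (h : RowLE Mᵀ B) {u : V → ℝ}
    (hu : ∀ x, u x ∈ Set.Icc (0 : ℝ) 1) : RowLE (SparseRemoval.scaleCols M u)ᵀ B := by
  refine ⟨fun x y => mul_nonneg (h.1 x y) (hu x).1, fun x => ?_⟩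
  refine (sum_le_sum fun y _ => ?_).trans (h.2 x)
  exact mul_le_of_le_one_right (h.1 x y) (hu x).2

/-- The walks of length four, with weights on the inner vertices. -/
def walk (g : Matrix V V ℝ) (u₁ u₂ u₃ : V → ℝ) : Matrix V V ℝ :=
  scaleCols g u₁ * scaleCols g u₂ * scaleCols g u₃ * g

lemma scaleCols_sub {U : Type*} (g f : Matrix U U ℝ) (u : U → ℝ) :
    scaleCols (g - f) u = scaleCols g u - scaleCols f u := by
  ext x y
  simp [scaleCols, sub_mul]

lemma CutLE.scaleCols {D : Matrix V V ℝ} {b : ℝ} (h : CutLE D b) {u : V → ℝ}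
    (hu : ∀ x, u x ∈ Set.Icc (0 : ℝ) 1) : CutLE (scaleCols D u) b := by
  intro w v hw hv
  have : SparseRemoval.scaleCols D u *ᵥ v = D *ᵥ (u * v) := by
    ext x
    simp [SparseRemoval.scaleCols, mulVec, dotProduct, mul_assoc]
  rw [this]
  exact h _ _ hw fun x => ⟨mul_nonneg (hu x).1 (hv x).1, mul_le_one₀ (hu x).2 (hv x).1 (hv x).2⟩

lemma rowLE_one [DecidableEq V] : RowLE (1 : Matrix V V ℝ) 1 := by
  refine ⟨fun x y => ?_, fun x => ?_⟩
  · rw [Matrix.one_apply]; split_ifs <;> simp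
  · simp [Matrix.one_apply]

/-- The telescoping estimate for walks of length four. -/
lemma cutLE_walk_sub {g f : Matrix V V ℝ} {b B : ℝ} (hB : 0 < B) (h : CutLE (g - f) b)
    (hg : RowLE g B) (hf : RowLE fᵀ B) {u₁ u₂ u₃ : V → ℝ}
    (h₁ : ∀ x, u₁ x ∈ Set.Icc (0 : ℝ) 1) (h₂ : ∀ x, u₂ x ∈ Set.Icc (0 : ℝ) 1)
    (h₃ : ∀ x, u₃ x ∈ Set.Icc (0 : ℝ) 1) :
    CutLE (walk g u₁ u₂ u₃ - walk f u₁ u₂ u₃) (4 * B ^ 3 * b) := by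
  classical
  -- Only f stands to the left of the difference and only g to the right, so column sums of f and
  -- row sums of g suffice.
  have e : walk g u₁ u₂ u₃ - walk f u₁ u₂ u₃ =
      1 * scaleCols (g - f) u₁ * (scaleCols g u₂ * (scaleCols g u₃ * g)) +
      scaleCols f u₁ * scaleCols (g - f) u₂ * (scaleCols g u₃ * g) +
      scaleCols f u₁ * scaleCols f u₂ * scaleCols (g - f) u₃ * g +
      scaleCols f u₁ * scaleCols f u₂ * scaleCols f u₃ * (g - f) * 1 := by
    simp only [walk, scaleCols_sub]
    noncomm_ring
  have hB0 := hB.le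
  have r2 : RowLE (scaleCols g u₃ * g) (B * B) := (hg.scaleCols h₃).mul hg hB0
  have r3 : RowLE (scaleCols g u₂ * (scaleCols g u₃ * g)) (B * (B * B)) :=
    (hg.scaleCols h₂).mul r2 (by positivity)
  have l1 := hf.scaleCols_transpose h₁
  have l2 : RowLE (scaleCols f u₁ * scaleCols f u₂)ᵀ (B * B) := by
    rw [transpose_mul]
    exact (hf.scaleCols_transpose h₂).mul l1 hB0
  have l3 : RowLE (scaleCols f u₁ * scaleCols f u₂ * scaleCols f u₃)ᵀ (B * (B * B)) := by
    rw [transpose_mul]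
    exact (hf.scaleCols_transpose h₃).mul l2 (by positivity)
  have o : RowLE (1 : Matrix V V ℝ)ᵀ 1 := by rw [transpose_one]; exact rowLE_one
  rw [e]
  have := (((h.scaleCols h₁).mul o r3 one_pos (by positivity)).add
    ((h.scaleCols h₂).mul l1 r2 hB (by positivity))).add
    ((h.scaleCols h₃).mul l2 hg (by positivity) hB) |>.add
    (h.mul l3 rowLE_one (by positivity) one_pos)
  convert this using 1
  ring

lemma avg_mem {r : Setoid V} {τ : ℝ} (hτ : 0 < τ) [Nonempty V] (hr : LargeCells r τ) (x y : V) :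
    avg r x y ∈ Set.Icc (0 : ℝ) (τ * Fintype.card V)⁻¹ :=
  ⟨avg_nonneg _ _ _, avg_le (mul_pos hτ (by exact_mod_cast Fintype.card_pos)) (hr x) y⟩

/-- F only sees the average of D over classes of r. Each entry of that average is a cut-norm test
with weights at most 1/(τN), hence at most b/(τN)², and there are N² entries. -/
lemma abs_pairing_le_of_cutLE [Nonempty V] {D F : Matrix V V ℝ} {b τ : ℝ} (hD : CutLE D b)
    {r : Setoid V} (hτ : 0 < τ) (hr : LargeCells r τ) (hF : ∀ x y, F x y ∈ Set.Icc (0 : ℝ) 1)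
    (hFr : ∀ x x' y y', r x x' → r y y' → F x y = F x' y') :
    |pairing F D| ≤ b / τ ^ 2 := by
  have hN : (0 : ℝ) < Fintype.card V := by exact_mod_cast Fintype.card_pos
  have key : ∀ x y, |step r D x y| ≤ (τ * Fintype.card V)⁻¹ * (τ * Fintype.card V)⁻¹ * b := by
    intro x y
    have e : step r D x y = (fun a => avg r x a) ⬝ᵥ (D *ᵥ fun a => avg r y a) := by
      rw [step_apply, dotProduct]
      refine sum_congr rfl fun a _ => ?_
      rw [mulVec, dotProduct, mul_sum]
      refine sum_congr rfl fun a' _ => ?_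
      rw [avg_symm r a' y, mul_assoc]
    rw [e]
    exact hD.apply_le (by positivity) (by positivity) (avg_mem hτ hr x) (avg_mem hτ hr y)
  rw [← step_of_const hFr, pairing_step]
  calc |pairing F (step r D)| ≤
      ∑ _x : V, ∑ _y : V, (τ * Fintype.card V)⁻¹ * (τ * Fintype.card V)⁻¹ * b := by
        refine (abs_sum_le_sum_abs _ _).trans (sum_le_sum fun x _ => ?_)
        refine (abs_sum_le_sum_abs _ _).trans (sum_le_sum fun y _ => ?_)
        rw [abs_mul, abs_of_nonneg (hF x y).1]
        exact (mul_le_of_le_one_left (abs_nonneg _) (hF x y).2).trans (key x y)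
    _ = b / τ ^ 2 := by
        simp only [sum_const, card_univ, nsmul_eq_mul]
        field_simp

lemma walk_apply (g : Matrix V V ℝ) (u₁ u₂ u₃ : V → ℝ) (a e : V) :
    walk g u₁ u₂ u₃ a e =
      ∑ b, ∑ c, ∑ d, g a b * u₁ b * (g b c * u₂ c) * (g c d * u₃ d) * g d e := by
  simp only [walk, mul_apply, scaleCols, sum_mul]
  rw [sum_comm, sum_congr rfl fun c _ => sum_comm, sum_comm]

open scoped Classical in
/-- The indicator matrix of the entries that are at least `h`. -/
noncomputable def thr {U : Type*} (h : ℝ) (f : Matrix U U ℝ) : Matrix U U ℝ :=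
  fun x y => if h ≤ f x y then 1 else 0

lemma thr_mem {U : Type*} (h : ℝ) (f : Matrix U U ℝ) (x y : U) : thr h f x y ∈ Set.Icc (0 : ℝ) 1 := by
  unfold thr
  split_ifs <;> simp

lemma mul_thr_le {U : Type*} {h : ℝ} {f : Matrix U U ℝ} (hf : ∀ x y, 0 ≤ f x y) (x y : U) :
    h * thr h f x y ≤ f x y := by
  unfold thr
  split_ifs with hh
  · simpa using hh
  · simpa using hf x y

lemma le_walk_of_thr {h : ℝ} (hh : 0 ≤ h) {f : Matrix V V ℝ} (hf : ∀ x y, 0 ≤ f x y)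
    {u₁ u₂ u₃ : V → ℝ} (h₁ : ∀ x, 0 ≤ u₁ x) (h₂ : ∀ x, 0 ≤ u₂ x) (h₃ : ∀ x, 0 ≤ u₃ x) (a e : V) :
    h ^ 4 * walk (thr h f) u₁ u₂ u₃ a e ≤ walk f u₁ u₂ u₃ a e := by
  rw [walk_apply, walk_apply]
  simp only [mul_sum]
  refine sum_le_sum fun b _ => sum_le_sum fun c _ => sum_le_sum fun d _ => ?_
  have t0 : ∀ x y, 0 ≤ h * thr h f x y := fun x y => mul_nonneg hh (thr_mem h f x y).1
  have t1 := mul_thr_le (h := h) hf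
  calc _ = h * thr h f a b * u₁ b * (h * thr h f b c * u₂ c) * (h * thr h f c d * u₃ d) *
        (h * thr h f d e) := by ring
    _ ≤ _ := by
      have p1 := mul_le_mul_of_nonneg_right (t1 a b) (h₁ b)
      have p2 := mul_le_mul_of_nonneg_right (t1 b c) (h₂ c)
      have p3 := mul_le_mul_of_nonneg_right (t1 c d) (h₃ d)
      have n2 := mul_nonneg (t0 b c) (h₂ c)
      have n3 := mul_nonneg (t0 c d) (h₃ d)
      have q1 := mul_nonneg (hf a b) (h₁ b)
      have q2 := mul_nonneg (hf b c) (h₂ c)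
      have q3 := mul_nonneg (hf c d) (h₃ d)
      exact mul_le_mul (mul_le_mul (mul_le_mul p1 p2 n2 q1) p3 n3 (mul_nonneg q1 q2))
        (t1 d e) (t0 d e) (mul_nonneg (mul_nonneg q1 q2) q3)

lemma sum_rotate (f : V → V → V → V → ℝ) :
    ∑ z, ∑ w, ∑ x, ∑ y, f z w x y = ∑ w, ∑ x, ∑ y, ∑ z, f z w x y := by
  rw [sum_comm]
  refine sum_congr rfl fun w _ => ?_
  rw [sum_comm]
  exact sum_congr rfl fun x _ => sum_comm

lemma one_sub_le_prod {p q r s t : ℝ} (hp : p ∈ Set.Icc (0 : ℝ) 1) (hq : q ∈ Set.Icc (0 : ℝ) 1)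
    (hr : r ∈ Set.Icc (0 : ℝ) 1) (hs : s ∈ Set.Icc (0 : ℝ) 1) (ht : t ∈ Set.Icc (0 : ℝ) 1) :
    1 - (1 - p) - (1 - q) - (1 - r) - (1 - s) - (1 - t) ≤ p * q * r * s * t := by
  have step : ∀ {m x y : ℝ}, x ∈ Set.Icc (0 : ℝ) 1 → y ∈ Set.Icc (0 : ℝ) 1 → m ≤ x →
      m - (1 - y) ≤ x * y := by
    intro m x y hx hy h
    nlinarith [mul_nonneg (sub_nonneg.2 hx.2) (sub_nonneg.2 hy.2)]
  have mem : ∀ {x y : ℝ}, x ∈ Set.Icc (0 : ℝ) 1 → y ∈ Set.Icc (0 : ℝ) 1 →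
      x * y ∈ Set.Icc (0 : ℝ) 1 := fun hx hy =>
    ⟨mul_nonneg hx.1 hy.1, mul_le_one₀ hx.2 hy.1 hy.2⟩
  have h1 : 1 - (1 - p) ≤ p := by linarith
  exact step (mem (mem (mem hp hq) hr) hs) ht
    (step (mem (mem hp hq) hr) hs (step (mem hp hq) hr (step hp hq h1)))

/-- If each of the five bipartite pieces of a five-partite weighted graph has few non-edges, then
most of the five-tuples form a five-cycle. -/
lemma le_sum_pentagons {a b c d e : V → ℝ} (ha : ∀ x, 0 ≤ a x) (hb : ∀ x, 0 ≤ b x)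
    (hc : ∀ x, 0 ≤ c x) (hd : ∀ x, 0 ≤ d x) (he : ∀ x, 0 ≤ e x) {R T : Matrix V V ℝ}
    (hR : ∀ x y, R x y ∈ Set.Icc (0 : ℝ) 1) (hT : ∀ x y, T x y ∈ Set.Icc (0 : ℝ) 1) {β : ℝ}
    (hab : ∑ x, ∑ y, a x * b y * (1 - R x y) ≤ β * ((∑ x, a x) * ∑ x, b x))
    (hbc : ∑ x, ∑ y, b x * c y * (1 - R x y) ≤ β * ((∑ x, b x) * ∑ x, c x))
    (hcd : ∑ x, ∑ y, c x * d y * (1 - R x y) ≤ β * ((∑ x, c x) * ∑ x, d x))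
    (hde : ∑ x, ∑ y, d x * e y * (1 - R x y) ≤ β * ((∑ x, d x) * ∑ x, e x))
    (hea : ∑ x, ∑ y, e x * a y * (1 - T x y) ≤ β * ((∑ x, e x) * ∑ x, a x)) :
    (1 - 5 * β) * ((∑ x, a x) * (∑ x, b x) * (∑ x, c x) * (∑ x, d x) * ∑ x, e x) ≤
      pairing (fun x y => a x * e y * T y x) (walk R b c d) := by
  have e0 : ∑ v, ∑ w, ∑ x, ∑ y, ∑ z, a v * (b w * (c x * (d y * e z))) =
      (∑ x, a x) * ((∑ x, b x) * ((∑ x, c x) * ((∑ x, d x) * ∑ x, e x))) := by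
    simp only [← mul_sum, ← sum_mul]
  have e1 : ∑ v, ∑ w, ∑ x, ∑ y, ∑ z, a v * b w * (1 - R v w) * (c x * (d y * e z)) =
      (∑ x, ∑ y, a x * b y * (1 - R x y)) * ((∑ x, c x) * ((∑ x, d x) * ∑ x, e x)) := by
    simp only [← mul_sum, ← sum_mul]
  have e2 : ∑ v, ∑ w, ∑ x, ∑ y, ∑ z, a v * (b w * c x * (1 - R w x) * (d y * e z)) =
      (∑ x, a x) * ((∑ x, ∑ y, b x * c y * (1 - R x y)) * ((∑ x, d x) * ∑ x, e x)) := by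
    simp only [← mul_sum, ← sum_mul]
  have e3 : ∑ v, ∑ w, ∑ x, ∑ y, ∑ z, a v * (b w * (c x * d y * (1 - R x y) * e z)) =
      (∑ x, a x) * ((∑ x, b x) * ((∑ x, ∑ y, c x * d y * (1 - R x y)) * ∑ x, e x)) := by
    simp only [← mul_sum, ← sum_mul]
  have e4 : ∑ v, ∑ w, ∑ x, ∑ y, ∑ z, a v * (b w * (c x * (d y * e z * (1 - R y z)))) =
      (∑ x, a x) * ((∑ x, b x) * ((∑ x, c x) * ∑ x, ∑ y, d x * e y * (1 - R x y))) := by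
    simp only [← mul_sum, ← sum_mul]
  have e5 : ∑ v, ∑ w, ∑ x, ∑ y, ∑ z, b w * (c x * (d y * (e z * a v * (1 - T z v)))) =
      (∑ x, b x) * ((∑ x, c x) * ((∑ x, d x) * ∑ x, ∑ y, e x * a y * (1 - T x y))) := by
    rw [sum_comm (s := (univ : Finset V)) (t := (univ : Finset V))
      (f := fun x y => e x * a y * (1 - T x y))]
    simp only [← mul_sum, ← sum_mul]
  -- A union bound: the product of five edge indicators is at least 1 minus the five defects, and
  -- each defect sum factors by `e1` to `e5`.
  have low : ∑ v, ∑ w, ∑ x, ∑ y, ∑ z, (a v * (b w * (c x * (d y * e z))) -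
        a v * b w * (1 - R v w) * (c x * (d y * e z)) -
        a v * (b w * c x * (1 - R w x) * (d y * e z)) -
        a v * (b w * (c x * d y * (1 - R x y) * e z)) -
        a v * (b w * (c x * (d y * e z * (1 - R y z)))) -
        b w * (c x * (d y * (e z * a v * (1 - T z v))))) ≤
      pairing (fun x y => a x * e y * T y x) (walk R b c d) := by
    simp only [pairing, walk_apply, mul_sum]
    refine sum_le_sum fun v _ => ?_
    rw [sum_rotate fun z w x y => a v * e z * T z v *
      (R v w * b w * (R w x * c x) * (R x y * d y) * R y z)]
    refine sum_le_sum fun w _ => sum_le_sum fun x _ => sum_le_sum fun y _ =>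
      sum_le_sum fun z _ => ?_
    have h := mul_le_mul_of_nonneg_left
      (one_sub_le_prod (hR v w) (hR w x) (hR x y) (hR y z) (hT z v))
      (mul_nonneg (ha v) (mul_nonneg (hb w) (mul_nonneg (hc x) (mul_nonneg (hd y) (he z)))))
    linarith
  simp only [sum_sub_distrib] at low
  rw [e0, e1, e2, e3, e4, e5] at low
  have A0 := sum_nonneg fun x (_ : x ∈ univ) => ha x
  have B0 := sum_nonneg fun x (_ : x ∈ univ) => hb x
  have C0 := sum_nonneg fun x (_ : x ∈ univ) => hc x
  have D0 := sum_nonneg fun x (_ : x ∈ univ) => hd x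
  have E0 := sum_nonneg fun x (_ : x ∈ univ) => he x
  generalize ∑ x, a x = sa at *
  generalize ∑ x, b x = sb at *
  generalize ∑ x, c x = sc at *
  generalize ∑ x, d x = sd at *
  generalize ∑ x, e x = se at *
  have m1 := mul_le_mul_of_nonneg_right hab (mul_nonneg C0 (mul_nonneg D0 E0))
  have m2 := mul_le_mul_of_nonneg_right hbc (mul_nonneg A0 (mul_nonneg D0 E0))
  have m3 := mul_le_mul_of_nonneg_right hcd (mul_nonneg A0 (mul_nonneg B0 E0))
  have m4 := mul_le_mul_of_nonneg_right hde (mul_nonneg A0 (mul_nonneg B0 C0))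
  have m5 := mul_le_mul_of_nonneg_right hea (mul_nonneg B0 (mul_nonneg C0 D0))
  refine le_trans ?_ low
  linarith

end SparseRemoval

/-! ### The counting lemma for pentagons. -/

namespace SparseRemoval

open Finset Matrix

variable {V : Type*} [Fintype V]

lemma pentSum_eq (A : Matrix V V ℝ) :
    pentSum A = ∑ a, ∑ c, ∑ d, (A * A) a c * A c d * (A * A) d a := by
  simp only [pentSum, mul_apply, mul_sum, sum_mul]
  refine sum_congr rfl fun a _ => ?_
  rw [sum_comm]
  refine sum_congr rfl fun c _ => ?_
  rw [sum_comm]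
  refine sum_congr rfl fun d _ => ?_
  rw [sum_comm]
  exact sum_congr rfl fun e _ => sum_congr rfl fun b _ => by ring

/-- The number of walks of length two whose middle vertex is weighted by `u`. -/
def twoWalk (A : Matrix V V ℝ) (u : V → ℝ) : Matrix V V ℝ := scaleCols A u * A

lemma twoWalk_apply (A : Matrix V V ℝ) (u : V → ℝ) (x z : V) :
    twoWalk A u x z = ∑ y, A x y * u y * A y z := rfl

lemma walk_eq_twoWalk (A : Matrix V V ℝ) (u₁ u₂ u₃ : V → ℝ) (a e : V) :
    walk A u₁ u₂ u₃ a e = ∑ c, twoWalk A u₁ a c * u₂ c * twoWalk A u₃ c e := by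
  have : walk A u₁ u₂ u₃ = scaleCols (twoWalk A u₁) u₂ * twoWalk A u₃ := by
    rw [walk, twoWalk, twoWalk, ← Matrix.mul_assoc]
    congr 2
    ext x y
    simp [mul_apply, scaleCols, sum_mul, mul_assoc]
  rw [this]
  rfl

variable {A : Matrix V V ℝ}

lemma twoWalk_zero_or_one_le (hA : ∀ x y, A x y = 0 ∨ A x y = 1) (C : Set V) (x z : V) :
    twoWalk A (ind C) x z = 0 ∨ 1 ≤ twoWalk A (ind C) x z := by
  have h01 : ∀ y, A x y * ind C y * A y z = 0 ∨ A x y * ind C y * A y z = 1 := by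
    intro y
    rcases hA x y with h | h <;> rcases hA y z with h' | h' <;> by_cases hy : y ∈ C <;>
      simp [h, h', ind, hy]
  rw [twoWalk_apply]
  by_cases h : ∀ y, A x y * ind C y * A y z = 0
  · left; simp [h]
  · right
    push Not at h
    obtain ⟨y, hy⟩ := h
    rw [← (h01 y).resolve_left hy]
    exact single_le_sum (f := fun y => A x y * ind C y * A y z)
      (fun y _ => by rcases h01 y with h | h <;> simp [h]) (mem_univ y)

lemma twoWalk_nonneg (hA : ∀ x y, A x y = 0 ∨ A x y = 1) (C : Set V) (x z : V) :
    0 ≤ twoWalk A (ind C) x z := by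
  rcases twoWalk_zero_or_one_le hA C x z with h | h <;> linarith

lemma twoWalk_le (hA : ∀ x y, A x y = 0 ∨ A x y = 1) (C : Set V) (x z : V) :
    twoWalk A (ind C) x z ≤ (A * A) x z := by
  refine sum_le_sum fun y _ => ?_
  refine mul_le_mul_of_nonneg_right ?_ (nonneg_of_zero_one hA _ _)
  exact mul_le_of_le_one_right (nonneg_of_zero_one hA _ _) (ind_mem C y).2

open scoped Classical in
/-- The indicator of the support of a matrix. -/
noncomputable def supp {U : Type*} (M : Matrix U U ℝ) : Matrix U U ℝ :=
  fun x y => if M x y = 0 then 0 else 1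

lemma supp_mem {U : Type*} (M : Matrix U U ℝ) (x y : U) : supp M x y ∈ Set.Icc (0 : ℝ) 1 := by
  unfold supp
  split_ifs <;> simp

lemma supp_le {U : Type*} {M : Matrix U U ℝ} {x y : U} (h : M x y = 0 ∨ 1 ≤ M x y) :
    supp M x y ≤ M x y := by
  unfold supp
  split_ifs with h0
  · exact h0.ge
  · exact h.resolve_left h0

/-- With p, q the two entries, the left side is p q (1 − (p + q)/L). If p + q ≤ L it is at most L²,
and otherwise it is not positive; it vanishes off the support. -/
lemma truncate_le {U : Type*} {M M' : Matrix U U ℝ} {x y x' y' : U} {L : ℝ} (hL : 0 < L)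
    (h : 0 ≤ M x y) (h' : 0 ≤ M' x' y') :
    M x y * M' x' y' - (M x y * M' x' y' ^ 2 + M x y ^ 2 * M' x' y') / L ≤
      L ^ 2 * (supp M x y * supp M' x' y') := by
  unfold supp
  by_cases h0 : M x y = 0
  · simp [h0]
  by_cases h0' : M' x' y' = 0
  · simp [h0']
  rw [if_neg h0, if_neg h0']
  generalize M x y = p at *
  generalize M' x' y' = q at *
  have e : p * q - (p * q ^ 2 + p ^ 2 * q) / L = p * q * (1 - (p + q) / L) := by
    field_simp
    ring
  rw [e]
  have hpq := mul_nonneg h h'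
  by_cases hl : p + q ≤ L
  · have h1 : 0 ≤ (p + q) / L := by positivity
    nlinarith [sq_nonneg (p - q)]
  · have h1 : 1 ≤ (p + q) / L := by
      rw [le_div_iff₀ hL]
      linarith
    nlinarith [sq_nonneg L]

lemma sum_mul_sq_le {M M' : Matrix V V ℝ} {B D : ℝ}
    (hB : ∀ x, ∑ y, M x y ≤ B) (hD : ∑ x, ∑ y, M' x y ^ 2 ≤ D) (hB0 : 0 ≤ B) :
    ∑ x, ∑ y, ∑ z, M x y * M' x z ^ 2 ≤ B * D := by
  calc ∑ x, ∑ y, ∑ z, M x y * M' x z ^ 2 = ∑ x, (∑ y, M x y) * ∑ z, M' x z ^ 2 := by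
        simp only [sum_mul_sum]
    _ ≤ ∑ x, B * ∑ z, M' x z ^ 2 := sum_le_sum fun x _ =>
        mul_le_mul_of_nonneg_right (hB x) (sum_nonneg fun _ _ => sq_nonneg _)
    _ ≤ B * D := by
        rw [← mul_sum]
        exact mul_le_mul_of_nonneg_left hD hB0

/-- The lower bound for the number of pentagons in terms of walks of length four. -/
lemma pentSum_ge_pairing {A : Matrix V V ℝ} {s K M L h ε : ℝ}
    (hA : ∀ x y, A x y = 0 ∨ A x y = 1) (hs : 0 < s) (hsN : s ^ 2 = Fintype.card V)
    (hK : 0 < K) (hrow : ∀ x, ∑ y, A x y ≤ K * s) (hcol : ∀ y, ∑ x, A x y ≤ K * s)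
    (hM : ∑ x, ∑ z, (A * A) x z ^ 2 ≤ M * Fintype.card V ^ 2) (hL : 0 < L) (hh : 0 ≤ h)
    {f : Matrix V V ℝ} (hf : ∀ x y, 0 ≤ f x y)
    (hcut : CutLE (s • A - f) (ε * Fintype.card V ^ 2)) (C₀ C₁ C₂ C₃ C₄ : Set V) :
    h / L ^ 2 * (pairing (fun w z => ind C₃ w * ind C₂ z * thr h f z w)
        (walk A (ind C₄) (ind C₀) (ind C₁)) - 2 * K ^ 2 * M * Fintype.card V ^ 3 / L) -
      ε * Fintype.card V ^ 3 ≤ s * pentSum A := by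
  set N : ℝ := (Fintype.card V : ℝ) with hN
  have hN0 : 0 ≤ N := by positivity
  set W := twoWalk A (ind C₁) with hW
  set W' := twoWalk A (ind C₄) with hW'
  have hA0 := nonneg_of_zero_one hA
  have hAA0 : ∀ x y, 0 ≤ (A * A) x y := fun x y =>
    sum_nonneg fun z _ => mul_nonneg (hA0 _ _) (hA0 _ _)
  have hKs : 0 ≤ K * s := by positivity
  have rAA : RowLE (A * A) (K ^ 2 * N) := by
    have h1 : RowLE A (K * s) := ⟨hA0, hrow⟩
    have h2 := h1.mul h1 hKs
    rwa [show K * s * (K * s) = K ^ 2 * N by rw [← hsN]; ring] at h2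
  have cAA : RowLE (A * A)ᵀ (K ^ 2 * N) := by
    have h1 : RowLE Aᵀ (K * s) := ⟨fun x y => hA0 y x, hcol⟩
    have h2 := h1.mul h1 hKs
    rwa [show K * s * (K * s) = K ^ 2 * N by rw [← hsN]; ring, ← transpose_mul] at h2
  -- Cut-norm test functions must be bounded, so the walk counts are replaced by indicators of their
  -- positivity; these are at most the counts, which are integers.
  set u : V → V → ℝ := fun x z => ind C₂ z * supp W x z with hu
  set v : V → V → ℝ := fun x w => ind C₃ w * supp W' w x with hv
  have hu01 : ∀ x z, u x z ∈ Set.Icc (0 : ℝ) 1 := fun x z =>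
    ⟨mul_nonneg (ind_mem _ _).1 (supp_mem _ _ _).1,
      mul_le_one₀ (ind_mem _ _).2 (supp_mem _ _ _).1 (supp_mem _ _ _).2⟩
  have hv01 : ∀ x z, v x z ∈ Set.Icc (0 : ℝ) 1 := fun x z =>
    ⟨mul_nonneg (ind_mem _ _).1 (supp_mem _ _ _).1,
      mul_le_one₀ (ind_mem _ _).2 (supp_mem _ _ _).1 (supp_mem _ _ _).2⟩
  have hu_le : ∀ x z, u x z ≤ (A * A) x z := fun x z =>
    (mul_le_of_le_one_left (supp_mem _ _ _).1 (ind_mem _ _).2).trans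
      ((supp_le (twoWalk_zero_or_one_le hA _ _ _)).trans (twoWalk_le hA _ _ _))
  have hv_le : ∀ x w, v x w ≤ (A * A) w x := fun x w =>
    (mul_le_of_le_one_left (supp_mem _ _ _).1 (ind_mem _ _).2).trans
      ((supp_le (twoWalk_zero_or_one_le hA _ _ _)).trans (twoWalk_le hA _ _ _))
  set Z : ℝ := ∑ x, ∑ z, ∑ w, ind C₀ x * (u x z * thr h f z w * v x w) with hZ
  have step1 : h * Z - ε * N ^ 3 ≤ s * pentSum A := by
    have h1 : ∀ x, h * (∑ z, ∑ w, ind C₀ x * (u x z * thr h f z w * v x w)) - ε * N ^ 2 ≤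
        s * ∑ z, ∑ w, (A * A) x z * A z w * (A * A) w x := by
      intro x
      have i0 := ind_mem C₀ x
      have c1 := (abs_le.1 (hcut (u x) (v x) (hu01 x) (hv01 x))).1
      have c2 : u x ⬝ᵥ ((s • A - f) *ᵥ v x) =
          s * (∑ z, ∑ w, u x z * A z w * v x w) - ∑ z, ∑ w, u x z * f z w * v x w := by
        simp only [dotProduct, mulVec, mul_sum, ← sum_sub_distrib, Matrix.sub_apply,
          Matrix.smul_apply, smul_eq_mul]
        exact sum_congr rfl fun z _ => sum_congr rfl fun w _ => by ring
      have c3 : ∑ z, ∑ w, u x z * A z w * v x w ≤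
          ∑ z, ∑ w, (A * A) x z * A z w * (A * A) w x := by
        refine sum_le_sum fun z _ => sum_le_sum fun w _ => ?_
        exact mul_le_mul (mul_le_mul_of_nonneg_right (hu_le x z) (hA0 z w)) (hv_le x w)
          (hv01 x w).1 (mul_nonneg (hAA0 _ _) (hA0 _ _))
      have c4 : h * (∑ z, ∑ w, ind C₀ x * (u x z * thr h f z w * v x w)) ≤
          ∑ z, ∑ w, u x z * f z w * v x w := by
        simp only [mul_sum]
        refine sum_le_sum fun z _ => sum_le_sum fun w _ => ?_
        have t := mul_le_mul_of_nonneg_left (mul_thr_le (h := h) hf z w)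
          (mul_nonneg (hu01 x z).1 (hv01 x w).1)
        have t0 := mul_nonneg (mul_nonneg (hu01 x z).1 (hv01 x w).1)
          (mul_nonneg hh (thr_mem h f z w).1)
        nlinarith [mul_le_of_le_one_left t0 i0.2]
      have c5 := mul_le_mul_of_nonneg_left c3 hs.le
      linarith
    have h2 := sum_le_sum fun x (_ : x ∈ univ) => h1 x
    simp only [sum_sub_distrib, ← mul_sum, sum_const, card_univ, nsmul_eq_mul] at h2
    rw [pentSum_eq, hZ]
    simp only [← mul_sum] at h2 ⊢
    rw [← hN] at h2
    linarith
  -- The truncation error has two terms, each a product of one 2-walk count and the square of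
  -- another at a common base vertex: at most K²N times M N².
  have step2 : pairing (fun w z => ind C₃ w * ind C₂ z * thr h f z w)
        (walk A (ind C₄) (ind C₀) (ind C₁)) - 2 * K ^ 2 * M * N ^ 3 / L ≤ L ^ 2 * Z := by
    have e1 : pairing (fun w z => ind C₃ w * ind C₂ z * thr h f z w)
        (walk A (ind C₄) (ind C₀) (ind C₁)) =
        ∑ x, ∑ z, ∑ w, ind C₀ x * (ind C₂ z * ind C₃ w * thr h f z w) * (W x z * W' w x) := by
      simp only [pairing, walk_eq_twoWalk, mul_sum]
      rw [sum_congr rfl fun w _ => sum_comm, sum_comm]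
      refine sum_congr rfl fun x _ => ?_
      rw [sum_comm]
      exact sum_congr rfl fun z _ => sum_congr rfl fun w _ => by ring
    have b1 : ∑ x, ∑ z, ∑ w, W x z * W' w x ^ 2 ≤ K ^ 2 * N * (M * N ^ 2) := by
      refine (sum_le_sum fun x _ => sum_le_sum fun z _ => sum_le_sum fun w _ => ?_).trans
        (sum_mul_sq_le (M := A * A) (M' := (A * A)ᵀ) rAA.2 ?_ (by positivity))
      · exact mul_le_mul (twoWalk_le hA _ _ _)
          (pow_le_pow_left₀ (twoWalk_nonneg hA _ _ _) (twoWalk_le hA _ _ _) 2) (sq_nonneg _)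
          (hAA0 _ _)
      · rw [sum_comm]; exact hM
    have b2 : ∑ x, ∑ z, ∑ w, W x z ^ 2 * W' w x ≤ K ^ 2 * N * (M * N ^ 2) := by
      rw [sum_congr rfl fun x _ => sum_comm]
      refine (sum_le_sum fun x _ => sum_le_sum fun z _ => sum_le_sum fun w _ => ?_).trans
        (sum_mul_sq_le (M := (A * A)ᵀ) (M' := A * A) cAA.2 hM (by positivity))
      rw [mul_comm]
      exact mul_le_mul (twoWalk_le hA _ _ _)
          (pow_le_pow_left₀ (twoWalk_nonneg hA _ _ _) (twoWalk_le hA _ _ _) 2) (sq_nonneg _)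
          (hAA0 _ _)
    have b3 : ∑ x, ∑ z, ∑ w, (ind C₀ x * (ind C₂ z * ind C₃ w * thr h f z w) *
          (W x z * W' w x) - (W x z * W' w x ^ 2 + W x z ^ 2 * W' w x) / L) ≤ L ^ 2 * Z := by
      simp only [hZ, mul_sum]
      refine sum_le_sum fun x _ => sum_le_sum fun z _ => sum_le_sum fun w _ => ?_
      have t := truncate_le (M := W) (M' := W') (x := x) (y := z) (x' := w) (y' := x) hL
        (twoWalk_nonneg hA _ _ _) (twoWalk_nonneg hA _ _ _)
      have w0 := twoWalk_nonneg hA C₁ x z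
      have w0' := twoWalk_nonneg hA C₄ w x
      have t1 : 0 ≤ (W x z * W' w x ^ 2 + W x z ^ 2 * W' w x) / L := by positivity
      have m0 : 0 ≤ ind C₀ x * (ind C₂ z * ind C₃ w * thr h f z w) :=
        mul_nonneg (ind_mem _ _).1 (mul_nonneg (mul_nonneg (ind_mem _ _).1 (ind_mem _ _).1)
          (thr_mem _ _ _ _).1)
      have m1 : ind C₀ x * (ind C₂ z * ind C₃ w * thr h f z w) ≤ 1 :=
        mul_le_one₀ (ind_mem _ _).2 (mul_nonneg (mul_nonneg (ind_mem _ _).1 (ind_mem _ _).1)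
          (thr_mem _ _ _ _).1) (mul_le_one₀ (mul_le_one₀ (ind_mem _ _).2 (ind_mem _ _).1
            (ind_mem _ _).2) (thr_mem _ _ _ _).1 (thr_mem _ _ _ _).2)
      have t2 := mul_le_mul_of_nonneg_left t m0
      have t3 := mul_le_mul_of_nonneg_right m1 t1
      simp only [hu, hv]
      linarith
    simp only [sum_sub_distrib, ← sum_div, sum_add_distrib] at b3
    rw [e1]
    refine le_trans ?_ b3
    have : (∑ x, ∑ z, ∑ w, W x z * W' w x ^ 2 + ∑ x, ∑ z, ∑ w, W x z ^ 2 * W' w x) / L ≤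
        2 * K ^ 2 * M * N ^ 3 / L := by
      refine div_le_div_of_nonneg_right ?_ hL.le
      linarith
    linarith
  have step3 := mul_le_mul_of_nonneg_left step2 (show 0 ≤ h / L ^ 2 by positivity)
  have e : h / L ^ 2 * (L ^ 2 * Z) = h * Z := by field_simp
  linarith

lemma walk_smul (s : ℝ) (A : Matrix V V ℝ) (u₁ u₂ u₃ : V → ℝ) :
    walk (s • A) u₁ u₂ u₃ = s ^ 4 • walk A u₁ u₂ u₃ := by
  ext a e
  simp only [walk_apply, Matrix.smul_apply, smul_eq_mul, mul_sum]
  exact sum_congr rfl fun b _ => sum_congr rfl fun c _ => sum_congr rfl fun d _ => by ring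

/-- The counting lemma for pentagons in a sparse graph. -/
lemma pentSum_ge {A : Matrix V V ℝ} [Nonempty V] {s K M L h ε₁ ε₂ β π τ : ℝ}
    (hA : ∀ x y, A x y = 0 ∨ A x y = 1) (hs : 0 < s) (hsN : s ^ 2 = Fintype.card V)
    (hK : 0 < K) (hrow : ∀ x, ∑ y, A x y ≤ K * s) (hcol : ∀ y, ∑ x, A x y ≤ K * s)
    (hM : ∑ x, ∑ z, (A * A) x z ^ 2 ≤ M * Fintype.card V ^ 2) (hL : 0 < L) (hh : 0 ≤ h)
    (hτ : 0 < τ) {Q₁ Q₂ : Setoid V} (hQ : LargeCells Q₁ τ)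
    (hcut₁ : CutLE (s • A - step Q₁ (s • A)) (ε₁ * Fintype.card V ^ 2))
    (hcut₂ : CutLE (s • A - step Q₂ (s • A)) (ε₂ * Fintype.card V ^ 2))
    {C₀ C₁ C₂ C₃ C₄ : Set V} (hC₂ : ∀ x y, Q₁ x y → (x ∈ C₂ ↔ y ∈ C₂))
    (hC₃ : ∀ x y, Q₁ x y → (x ∈ C₃ ↔ y ∈ C₃))
    (h01 : ∑ x, ∑ y, ind C₀ x * ind C₁ y * (1 - thr h (step Q₂ (s • A)) x y) ≤
      β * ((∑ x, ind C₀ x) * ∑ x, ind C₁ x))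
    (h12 : ∑ x, ∑ y, ind C₁ x * ind C₂ y * (1 - thr h (step Q₂ (s • A)) x y) ≤
      β * ((∑ x, ind C₁ x) * ∑ x, ind C₂ x))
    (h23 : ∑ x, ∑ y, ind C₂ x * ind C₃ y * (1 - thr h (step Q₁ (s • A)) x y) ≤
      β * ((∑ x, ind C₂ x) * ∑ x, ind C₃ x))
    (h34 : ∑ x, ∑ y, ind C₃ x * ind C₄ y * (1 - thr h (step Q₂ (s • A)) x y) ≤
      β * ((∑ x, ind C₃ x) * ∑ x, ind C₄ x))
    (h40 : ∑ x, ∑ y, ind C₄ x * ind C₀ y * (1 - thr h (step Q₂ (s • A)) x y) ≤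
      β * ((∑ x, ind C₄ x) * ∑ x, ind C₀ x))
    (hπ : π * Fintype.card V ^ 5 ≤ (1 - 5 * β) * ((∑ x, ind C₃ x) * (∑ x, ind C₄ x) *
      (∑ x, ind C₀ x) * (∑ x, ind C₁ x) * ∑ x, ind C₂ x)) :
    (h / L ^ 2 * (h ^ 4 * π - 4 * K ^ 3 * ε₂ / τ ^ 2 - 2 * K ^ 2 * M / L) - ε₁) *
      Fintype.card V ^ 3 ≤ s * pentSum A := by
  set N : ℝ := (Fintype.card V : ℝ) with hN
  have hN0 : 0 < N := by rw [hN]; exact_mod_cast Fintype.card_pos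
  have hg0 : ∀ x y, 0 ≤ (s • A) x y := fun x y => mul_nonneg hs.le (nonneg_of_zero_one hA x y)
  have hrow' : ∀ x, ∑ y, (s • A) x y ≤ K * N := by
    intro x
    simp only [Matrix.smul_apply, smul_eq_mul, ← mul_sum]
    calc s * ∑ y, A x y ≤ s * (K * s) := mul_le_mul_of_nonneg_left (hrow x) hs.le
      _ = K * N := by rw [← hsN]; ring
  have hcol' : ∀ y, ∑ x, (s • A) x y ≤ K * N := by
    intro y
    simp only [Matrix.smul_apply, smul_eq_mul, ← mul_sum]
    calc s * ∑ x, A x y ≤ s * (K * s) := mul_le_mul_of_nonneg_left (hcol y) hs.le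
      _ = K * N := by rw [← hsN]; ring
  set F : Matrix V V ℝ := fun w z => ind C₃ w * ind C₂ z * thr h (step Q₁ (s • A)) z w with hF
  have main := pentSum_ge_pairing hA hs hsN hK hrow hcol hM hL hh
    (step_nonneg (r := Q₁) hg0) hcut₁ C₀ C₁ C₂ C₃ C₄
  rw [← hF, ← hN] at main
  have hF01 : ∀ x y, F x y ∈ Set.Icc (0 : ℝ) 1 := fun x y =>
    ⟨mul_nonneg (mul_nonneg (ind_mem _ _).1 (ind_mem _ _).1) (thr_mem _ _ _ _).1,
      mul_le_one₀ (mul_le_one₀ (ind_mem _ _).2 (ind_mem _ _).1 (ind_mem _ _).2)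
        (thr_mem _ _ _ _).1 (thr_mem _ _ _ _).2⟩
  have hFr : ∀ x x' y y', Q₁ x x' → Q₁ y y' → F x y = F x' y' := by
    intro x x' y y' hx hy
    simp only [hF, thr, step_congr _ hy hx, ind_eq_of_iff (hC₃ _ _ hx),
      ind_eq_of_iff (hC₂ _ _ hy)]
  have c1 := abs_pairing_le_of_cutLE (cutLE_walk_sub (B := K * N) (by positivity) hcut₂
    ⟨hg0, hrow'⟩ ⟨fun x y => step_nonneg (r := Q₂) hg0 y x, sum_step_col_le hcol'⟩
    (ind_mem C₄) (ind_mem C₀) (ind_mem C₁)) hτ hQ hF01 hFr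
  have c2 : pairing F (walk (s • A) (ind C₄) (ind C₀) (ind C₁) -
      walk (step Q₂ (s • A)) (ind C₄) (ind C₀) (ind C₁)) =
      N ^ 2 * pairing F (walk A (ind C₄) (ind C₀) (ind C₁)) -
      pairing F (walk (step Q₂ (s • A)) (ind C₄) (ind C₀) (ind C₁)) := by
    -- Four edges each carry the normalization s.
    have : s ^ 4 = N ^ 2 := by rw [← hsN]; ring
    simp only [pairing, walk_smul, Matrix.sub_apply, Matrix.smul_apply, smul_eq_mul, mul_sub,
      sum_sub_distrib, mul_sum, this]
    congr 1
    exact sum_congr rfl fun x _ => sum_congr rfl fun y _ => by ring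
  have c3 : h ^ 4 * pairing F (walk (thr h (step Q₂ (s • A))) (ind C₄) (ind C₀) (ind C₁)) ≤
      pairing F (walk (step Q₂ (s • A)) (ind C₄) (ind C₀) (ind C₁)) := by
    simp only [pairing, mul_sum]
    refine sum_le_sum fun x _ => sum_le_sum fun y _ => ?_
    have := mul_le_mul_of_nonneg_left (le_walk_of_thr hh (step_nonneg (r := Q₂) hg0)
      (fun x => (ind_mem C₄ x).1) (fun x => (ind_mem C₀ x).1) (fun x => (ind_mem C₁ x).1) x y)
      (hF01 x y).1
    linarith
  have c4 := le_sum_pentagons (fun x => (ind_mem C₃ x).1) (fun x => (ind_mem C₄ x).1)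
    (fun x => (ind_mem C₀ x).1) (fun x => (ind_mem C₁ x).1) (fun x => (ind_mem C₂ x).1)
    (thr_mem h (step Q₂ (s • A))) (thr_mem h (step Q₁ (s • A))) h34 h40 h01 h12 h23
  have c5 := mul_le_mul_of_nonneg_left (hπ.trans c4) (show 0 ≤ h ^ 4 by positivity)
  rw [c2] at c1
  have c6 := (abs_le.1 c1).1
  have c7 : (h ^ 4 * π - 4 * K ^ 3 * ε₂ / τ ^ 2) * N ^ 3 ≤
      pairing F (walk A (ind C₄) (ind C₀) (ind C₁)) := by
    refine le_of_mul_le_mul_left ?_ (show 0 < N ^ 2 by positivity)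
    have e : 4 * (K * N) ^ 3 * (ε₂ * N ^ 2) / τ ^ 2 = N ^ 2 * (4 * K ^ 3 * ε₂ / τ ^ 2 * N ^ 3) := by
      ring
    rw [e] at c6
    linarith
  have c8 := mul_le_mul_of_nonneg_left c7 (show 0 ≤ h / L ^ 2 by positivity)
  have e2 : 2 * K ^ 2 * M * N ^ 3 / L = 2 * K ^ 2 * M / L * N ^ 3 := by ring
  rw [e2] at main
  linarith

end SparseRemoval

/-! ### Cleaning the graph and the removal lemma. -/

namespace SparseRemoval

open Finset Matrix

variable {V : Type*} [Fintype V]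

lemma ind_eq_avg (P : Setoid V) (v x : V) : ind {y | P v y} x = cellCard P v * avg P v x := by
  by_cases h : P v x
  · simp [ind, avg, h, (cellCard_pos P v).ne']
  · simp [ind, avg, h]

lemma sum_ind_cell (P : Setoid V) (v : V) : ∑ x, ind {y | P v y} x = cellCard P v := by
  simp_rw [ind_eq_avg]
  rw [← mul_sum, sum_avg, mul_one]

lemma sum_step (P : Setoid V) (D : Matrix V V ℝ) :
    ∑ x, ∑ y, step P D x y = ∑ x, ∑ y, D x y := by
  have := pairing_step_of_const (r := P) (g := D) (F := fun _ _ => 1) (fun _ _ _ _ _ _ => rfl)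
  simpa [pairing] using this

lemma pentSum_mono {A A' : Matrix V V ℝ} (h0 : ∀ x y, 0 ≤ A' x y) (h : ∀ x y, A' x y ≤ A x y) :
    pentSum A' ≤ pentSum A := by
  refine sum_le_sum fun a _ => sum_le_sum fun b _ => sum_le_sum fun c _ => sum_le_sum fun d _ =>
    sum_le_sum fun e _ => ?_
  have hA : ∀ x y, 0 ≤ A x y := fun x y => (h0 x y).trans (h x y)
  have := h0 a b; have := h0 b c; have := h0 c d; have := h0 d e; have := h0 e a
  have := hA a b; have := hA b c; have := hA c d; have := hA d e; have := hA e a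
  gcongr <;> apply h

lemma rectSum_mono {A A' : Matrix V V ℝ} (h0 : ∀ x y, 0 ≤ A' x y) (h : ∀ x y, A' x y ≤ A x y) :
    rectSum A' ≤ rectSum A := by
  refine sum_le_sum fun b _ => sum_le_sum fun b' _ => sum_le_sum fun a _ => sum_le_sum fun a' _ => ?_
  split_ifs
  · have hA : ∀ x y, 0 ≤ A x y := fun x y => (h0 x y).trans (h x y)
    have := h0 a b; have := h0 a b'; have := h0 a' b; have := h0 a' b'
    have := hA a b; have := hA a b'; have := hA a' b; have := hA a' b'
    gcongr <;> apply h
  · rfl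

/-- The squared difference of the averages of `g` over two partitions. -/
noncomputable def sqDev (P Q : Setoid V) (g : Matrix V V ℝ) : Matrix V V ℝ :=
  fun x y => (step Q g x y - step P g x y) ^ 2

lemma sqDev_nonneg (P Q : Setoid V) (g : Matrix V V ℝ) (x y : V) : 0 ≤ sqDev P Q g x y :=
  sq_nonneg _

lemma sum_sqDev {P Q : Setoid V} (h : Q ≤ P) (g : Matrix V V ℝ) :
    ∑ x, ∑ y, sqDev P Q g x y = energy Q g - energy P g := sum_sq_step_sub h g

/-- A pair of classes on which `step Q g` is close to `step P g`, which is not small, has few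
entries where `step Q g` is small. -/
lemma sum_one_sub_thr_le {P Q : Setoid V} {g : Matrix V V ℝ} {h β : ℝ} (hh : 0 < h) {v w : V}
    (hvw : 2 * h ≤ step P g v w)
    (hD : step P (sqDev P Q g) v w ≤ β * h ^ 2) :
    ∑ x, ∑ y, ind {y | P v y} x * ind {y | P w y} y * (1 - thr h (step Q g) x y) ≤
      β * ((∑ x, ind {y | P v y} x) * ∑ x, ind {y | P w y} x) := by
  have hcv := cellCard_pos P v
  have hcw := cellCard_pos P w
  have key : h ^ 2 * ∑ x, ∑ y, ind {y | P v y} x * ind {y | P w y} y *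
      (1 - thr h (step Q g) x y) ≤
      cellCard P v * cellCard P w *
        step P (sqDev P Q g) v w := by
    rw [step_apply]
    simp only [mul_sum]
    refine sum_le_sum fun x _ => sum_le_sum fun y _ => ?_
    rw [avg_symm P y w]
    have e : cellCard P v * cellCard P w * (avg P v x * sqDev P Q g x y *
        avg P w y) = ind {y | P v y} x * ind {y | P w y} y *
          sqDev P Q g x y := by
      rw [ind_eq_avg, ind_eq_avg]; ring
    rw [e, mul_left_comm]
    by_cases hx : P v x
    · by_cases hy : P w y
      · refine mul_le_mul_of_nonneg_left ?_ (mul_nonneg (ind_mem _ _).1 (ind_mem _ _).1)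
        have hP : step P g x y = step P g v w := step_congr g (P.symm hx) (P.symm hy)
        unfold thr sqDev
        split_ifs with ht
        · simpa using sq_nonneg _
        · rw [hP]
          nlinarith
      · simp [ind, hy]
    · simp [ind, hx]
  rw [sum_ind_cell, sum_ind_cell]
  have := mul_le_mul_of_nonneg_left hD (mul_pos hcv hcw).le
  refine le_of_mul_le_mul_left ?_ (show 0 < h ^ 2 by positivity)
  linarith

open scoped Classical in
/-- The mass of the entries for which the local deviation is large. -/
lemma sum_ite_dev_le {P : Setoid V} {f D : Matrix V V ℝ} {ν η C N : ℝ} (hν : 0 < ν)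
    (hD0 : ∀ x y, 0 ≤ D x y) (hD : ∑ x, ∑ y, D x y ≤ η * N ^ 2)
    (hf : pairing f f ≤ C * N ^ 2) {ε : ℝ} (hε : 0 ≤ ε) (hε' : C * (η / ν) ≤ ε ^ 2) :
    pairing f (fun x y => if ν < step P D x y then 1 else 0) ≤ ε * N ^ 2 := by
  -- Cauchy–Schwarz against the indicator of the exceptional entries, whose number `h2` bounds by
  -- Markov's inequality: averaging over P preserves the total of D.
  have h1 := pairing_sq_le f (fun x y => if ν < step P D x y then 1 else 0)
  set F : Matrix V V ℝ := fun x y => if ν < step P D x y then 1 else 0 with hF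
  have h2 : pairing F F ≤ η / ν * N ^ 2 := by
    have : ν * pairing F F ≤ η * N ^ 2 := by
      rw [← sum_step P] at hD
      refine le_trans ?_ hD
      simp only [pairing, mul_sum]
      refine sum_le_sum fun x _ => sum_le_sum fun y _ => ?_
      simp only [hF]
      split_ifs with h
      · simpa using h.le
      · simpa using step_nonneg hD0 x y
    rw [div_mul_eq_mul_div, le_div_iff₀ hν]
    linarith
  have h0 : 0 ≤ pairing F F := sum_nonneg fun _ _ => sum_nonneg fun _ _ => mul_self_nonneg _
  have h3 : pairing f F ^ 2 ≤ (ε * N ^ 2) ^ 2 := by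
    calc pairing f F ^ 2 ≤ C * N ^ 2 * (η / ν * N ^ 2) :=
          h1.trans (mul_le_mul hf h2 h0 ((sum_nonneg fun _ _ => sum_nonneg fun _ _ =>
            mul_self_nonneg _).trans hf))
      _ = C * (η / ν) * (N ^ 2) ^ 2 := by ring
      _ ≤ ε ^ 2 * (N ^ 2) ^ 2 := mul_le_mul_of_nonneg_right hε' (by positivity)
      _ = _ := by ring
  exact (abs_le_of_sq_le_sq' h3 (by positivity)).2

lemma exists_of_pentSum_ne_zero {A : Matrix V V ℝ} (h : pentSum A ≠ 0) :
    ∃ a b c d e, A a b ≠ 0 ∧ A b c ≠ 0 ∧ A c d ≠ 0 ∧ A d e ≠ 0 ∧ A e a ≠ 0 := by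
  by_contra! H
  refine h (sum_eq_zero fun a _ => sum_eq_zero fun b _ => sum_eq_zero fun c _ =>
    sum_eq_zero fun d _ => sum_eq_zero fun e _ => ?_)
  have := H a b c d e
  by_cases h1 : A a b = 0 <;> by_cases h2 : A b c = 0 <;> by_cases h3 : A c d = 0 <;>
    by_cases h4 : A d e = 0 <;> simp_all

lemma one_le_pentSum {A : Matrix V V ℝ} (hA : ∀ x y, A x y = 0 ∨ A x y = 1) {a b c d e : V}
    (h1 : A a b ≠ 0) (h2 : A b c ≠ 0) (h3 : A c d ≠ 0) (h4 : A d e ≠ 0) (h5 : A e a ≠ 0) :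
    1 ≤ pentSum A := by
  have hA0 := nonneg_of_zero_one hA
  have n : ∀ a b c d e, 0 ≤ A a b * A b c * A c d * A d e * A e a := fun a b c d e => by
    have := hA0 a b; have := hA0 b c; have := hA0 c d; have := hA0 d e; have := hA0 e a
    positivity
  calc (1 : ℝ) = A a b * A b c * A c d * A d e * A e a := by
        rw [(hA _ _).resolve_left h1, (hA _ _).resolve_left h2, (hA _ _).resolve_left h3,
          (hA _ _).resolve_left h4, (hA _ _).resolve_left h5]
        norm_num
    _ ≤ ∑ e, A a b * A b c * A c d * A d e * A e a :=
        single_le_sum (f := fun e => A a b * A b c * A c d * A d e * A e a)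
          (fun _ _ => n _ _ _ _ _) (mem_univ e)
    _ ≤ ∑ d, ∑ e, A a b * A b c * A c d * A d e * A e a :=
        single_le_sum (f := fun d => ∑ e, A a b * A b c * A c d * A d e * A e a)
          (fun _ _ => sum_nonneg fun _ _ => n _ _ _ _ _) (mem_univ d)
    _ ≤ ∑ c, ∑ d, ∑ e, A a b * A b c * A c d * A d e * A e a :=
        single_le_sum (f := fun c => ∑ d, ∑ e, A a b * A b c * A c d * A d e * A e a)
          (fun _ _ => sum_nonneg fun _ _ => sum_nonneg fun _ _ => n _ _ _ _ _) (mem_univ c)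
    _ ≤ ∑ b, ∑ c, ∑ d, ∑ e, A a b * A b c * A c d * A d e * A e a :=
        single_le_sum (f := fun b => ∑ c, ∑ d, ∑ e, A a b * A b c * A c d * A d e * A e a)
          (fun _ _ => sum_nonneg fun _ _ => sum_nonneg fun _ _ => sum_nonneg fun _ _ =>
            n _ _ _ _ _) (mem_univ b)
    _ ≤ pentSum A :=
        single_le_sum
          (f := fun a => ∑ b, ∑ c, ∑ d, ∑ e, A a b * A b c * A c d * A d e * A e a)
          (fun _ _ => sum_nonneg fun _ _ => sum_nonneg fun _ _ => sum_nonneg fun _ _ =>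
            sum_nonneg fun _ _ => n _ _ _ _ _) (mem_univ a)

universe u

/-- The choice of constants in the removal lemma. -/
lemma count_constants {h K M a b κ₁ κ₂ τ₀ τ₁ τ : ℝ} (hh : 0 < h) (hK : 0 < K) (hM : 0 < M)
    (ha : a = 3 / 4 * h ^ 4) (hb : b = 8 * K ^ 2 * M / a) (hκ₁ : κ₁ = h * a / (4 * b ^ 2))
    (hκ₂ : κ₂ = a / (16 * K ^ 3)) (hτ₀ : 0 < τ₀) (hτ₁₀ : τ₀ ≤ τ₁) (hτ₁ : τ₁ ≤ τ) :
    κ₁ * τ₀ ^ 15 ≤ h / (b / τ ^ 5) ^ 2 * (h ^ 4 * (3 / 4 * τ ^ 5) -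
      4 * K ^ 3 * min (κ₁ * τ₁ ^ 15) (κ₂ * τ₁ ^ 7) / τ₁ ^ 2 - 2 * K ^ 2 * M / (b / τ ^ 5)) -
        min (κ₁ * τ ^ 15) (κ₂ * τ ^ 7) := by
  have ha0 : 0 < a := by rw [ha]; positivity
  have hb0 : 0 < b := by rw [hb]; positivity
  have hκ₁0 : 0 < κ₁ := by rw [hκ₁]; positivity
  have hκ₂0 : 0 < κ₂ := by rw [hκ₂]; positivity
  have hτ₁0 := hτ₀.trans_le hτ₁₀
  have hτ0 := hτ₁0.trans_le hτ₁
  have k1 : min (κ₁ * τ ^ 15) (κ₂ * τ ^ 7) ≤ κ₁ * τ ^ 15 := min_le_left _ _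
  -- The main term is a τ⁵, and `k2` and `k3` each remove a quarter of it. The exponent 7 is 5 plus
  -- 2 for the division by τ₁²; 15 is 5 plus 10 for the division by L², where L = b/τ⁵.
  have k2 : 4 * K ^ 3 * min (κ₁ * τ₁ ^ 15) (κ₂ * τ₁ ^ 7) / τ₁ ^ 2 ≤ a / 4 * τ ^ 5 := by
    have q1 : min (κ₁ * τ₁ ^ 15) (κ₂ * τ₁ ^ 7) ≤ κ₂ * τ₁ ^ 7 := min_le_right _ _
    calc 4 * K ^ 3 * min (κ₁ * τ₁ ^ 15) (κ₂ * τ₁ ^ 7) / τ₁ ^ 2 ≤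
        4 * K ^ 3 * (κ₂ * τ₁ ^ 7) / τ₁ ^ 2 := by gcongr
      _ = a / 4 * τ₁ ^ 5 := by rw [hκ₂]; field_simp; norm_num
      _ ≤ a / 4 * τ ^ 5 := by gcongr
  have k3 : 2 * K ^ 2 * M / (b / τ ^ 5) = a / 4 * τ ^ 5 := by
    rw [hb]; field_simp; norm_num
  have k4 : h / (b / τ ^ 5) ^ 2 * (a / 2 * τ ^ 5) = 2 * (κ₁ * τ ^ 15) := by
    rw [hκ₁]; field_simp; norm_num
  have k5 : h / (b / τ ^ 5) ^ 2 * (a / 2 * τ ^ 5) ≤ h / (b / τ ^ 5) ^ 2 *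
      (h ^ 4 * (3 / 4 * τ ^ 5) -
        4 * K ^ 3 * min (κ₁ * τ₁ ^ 15) (κ₂ * τ₁ ^ 7) / τ₁ ^ 2 -
          2 * K ^ 2 * M / (b / τ ^ 5)) := by
    refine mul_le_mul_of_nonneg_left ?_ (by positivity)
    rw [k3]
    have : h ^ 4 * (3 / 4 * τ ^ 5) = a * τ ^ 5 := by rw [ha]; ring
    linarith
  have k6 : κ₁ * τ₀ ^ 15 ≤ κ₁ * τ ^ 15 := by
    have := hτ₁₀.trans hτ₁
    gcongr
  linarith

/-- The pentagon removal lemma for sparse directed graphs of bounded normalized degree. -/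
theorem pentagon_removal_of_degree_le {ε K : ℝ} (hε : 0 < ε) (hK : 0 < K) :
    ∃ δ s₀ : ℝ, 0 < δ ∧ ∀ (V : Type u) [Fintype V] [Nonempty V] (A : Matrix V V ℝ) (s : ℝ),
      (∀ x y, A x y = 0 ∨ A x y = 1) → 0 < s → s₀ ≤ s → s ^ 2 = Fintype.card V →
      (∀ x, ∑ y, A x y ≤ K * s) → (∀ y, ∑ x, A x y ≤ K * s) →
      rectSum A ≤ δ * Fintype.card V ^ 2 → s * pentSum A ≤ δ * Fintype.card V ^ 3 →
      ∃ A' : Matrix V V ℝ, (∀ x y, A' x y = 0 ∨ A' x y = 1) ∧ (∀ x y, A' x y ≤ A x y) ∧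
        s * ∑ x, ∑ y, (A x y - A' x y) ≤ ε * Fintype.card V ^ 2 ∧ pentSum A' = 0 := by
  -- Each of the three reasons for deletion may cost ε/3: small averages cost 2h, and large
  -- deviations cost the root of 3η/ν, with 3 the energy bound. The value ν = h²/20 gives defect β =
  -- 1/20, so 1 − 5β = 3/4.
  set h : ℝ := ε / 6 with hh
  have hh0 : 0 < h := by positivity
  set ν : ℝ := 1 / 20 * h ^ 2 with hν
  have hν0 : 0 < ν := by positivity
  set η : ℝ := ν * ε ^ 2 / 27 with hη
  have hη0 : 0 < η := by positivity
  set M : ℝ := K ^ 2 + 3 with hM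
  have hM0 : 0 < M := by positivity
  set a : ℝ := 3 / 4 * h ^ 4 with ha
  have ha0 : 0 < a := by positivity
  set b : ℝ := 8 * K ^ 2 * M / a with hb
  have hb0 : 0 < b := by positivity
  set κ₁ : ℝ := h * a / (4 * b ^ 2) with hκ₁
  have hκ₁0 : 0 < κ₁ := by positivity
  set κ₂ : ℝ := a / (16 * K ^ 3) with hκ₂
  have hκ₂0 : 0 < κ₂ := by positivity
  obtain ⟨τ₀, hτ₀, H⟩ := exists_strong_regular.{u} K 3 hη0
    (e := fun t => min (κ₁ * t ^ 15) (κ₂ * t ^ 7)) (fun t ht => by positivity)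
  -- The bound τ₀ on δ and the bound K/τ₀ on s make each term of `energy_le` at most N²; the bound 1
  -- gives M; the last is half of the pentagon count to be contradicted.
  refine ⟨min (min 1 τ₀) (κ₁ * τ₀ ^ 15 / 2), K / τ₀, by positivity, ?_⟩
  intro V _ _ A s hA hs hs₀ hsN hrow hcol hrect hpent
  have hN0 : (0 : ℝ) < Fintype.card V := by exact_mod_cast Fintype.card_pos
  set N : ℝ := (Fintype.card V : ℝ) with hN
  have hrect1 : rectSum A ≤ N ^ 2 := by
    refine hrect.trans (mul_le_of_le_one_left (by positivity) ?_)
    exact (min_le_left _ _).trans (min_le_left _ _)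
  have hrect2 : rectSum A ≤ τ₀ * N ^ 2 := hrect.trans
    (mul_le_mul_of_nonneg_right ((min_le_left _ _).trans (min_le_right _ _)) (by positivity))
  have hpent' : s * pentSum A ≤ κ₁ * τ₀ ^ 15 / 2 * N ^ 3 := hpent.trans
    (mul_le_mul_of_nonneg_right (min_le_right _ _) (by positivity))
  set g : Matrix V V ℝ := s • A with hg
  have hg0 : ∀ x y, 0 ≤ g x y := fun x y => mul_nonneg hs.le (nonneg_of_zero_one hA x y)
  have hrow' : ∀ x, ∑ y, g x y ≤ K * N := by
    intro x
    simp only [hg, Matrix.smul_apply, smul_eq_mul, ← mul_sum]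
    calc s * ∑ y, A x y ≤ s * (K * s) := mul_le_mul_of_nonneg_left (hrow x) hs.le
      _ = K * N := by rw [← hsN]; ring
  have hcol' : ∀ y, ∑ x, g x y ≤ K * N := by
    intro y
    simp only [hg, Matrix.smul_apply, smul_eq_mul, ← mul_sum]
    calc s * ∑ x, A x y ≤ s * (K * s) := mul_le_mul_of_nonneg_left (hcol y) hs.le
      _ = K * N := by rw [← hsN]; ring
  have hen : ∀ (τ : ℝ) (r : Setoid V), τ₀ ≤ τ → LargeCells r τ → energy r g ≤ 3 * N ^ 2 := by
    intro τ r hτ hr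
    have hτ0 := hτ₀.trans_le hτ
    refine (energy_le hA hsN hcol hτ0 hr).trans ?_
    have h1 : rectSum A / τ ≤ N ^ 2 := by
      rw [div_le_iff₀ hτ0]
      nlinarith [mul_le_mul_of_nonneg_right hτ (sq_nonneg N)]
    have h2 : K * s / τ ≤ N := by
      rw [← hsN, div_le_iff₀ hτ0]
      rw [div_le_iff₀ hτ₀] at hs₀
      nlinarith [mul_le_mul_of_nonneg_left hτ (mul_pos hs hs).le]
    nlinarith [mul_le_mul_of_nonneg_left h2 hN0.le]
  obtain ⟨τ, τ₁, P, Q₁, Q₂, hτ₁₀, hτ₁, hτ1, hQ₁, hQ₂, hlP, hl₁, hl₂, hc₁, hc₂, hE⟩ :=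
    H V g hg0 hrow' hcol' (fun r => hen τ₀ r le_rfl)
  have hτ₁0 := hτ₀.trans_le hτ₁₀
  have hτ0 := hτ₁0.trans_le hτ₁
  have hE₁ : ∑ x, ∑ y, sqDev P Q₁ g x y ≤ η * N ^ 2 := by
    rw [sum_sqDev hQ₁]
    linarith [energy_mono hQ₂ g]
  have hE₂ : ∑ x, ∑ y, sqDev P Q₂ g x y ≤ η * N ^ 2 := by
    rw [sum_sqDev (hQ₂.trans hQ₁)]
    exact hE
  classical
  set bad : V → V → Prop := fun x y =>
    step P g x y < 2 * h ∨ ν < step P (sqDev P Q₁ g) x y ∨ ν < step P (sqDev P Q₂ g) x y with hbad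
  refine ⟨fun x y => if bad x y then 0 else A x y, fun x y => ?_, fun x y => ?_, ?_, ?_⟩
  · dsimp only
    split_ifs
    · exact Or.inl rfl
    · exact hA x y
  · dsimp only
    split_ifs
    · exact nonneg_of_zero_one hA x y
    · rfl
  · set F : Matrix V V ℝ := fun x y => if bad x y then 1 else 0 with hF
    have e1 : s * ∑ x, ∑ y, (A x y - if bad x y then 0 else A x y) = pairing g F := by
      simp only [pairing, mul_sum, hg, hF, Matrix.smul_apply, smul_eq_mul]
      refine sum_congr rfl fun x _ => sum_congr rfl fun y _ => ?_
      split_ifs <;> simp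
    -- Badness depends only on the classes of P, so the deleted mass of g is that of its average, to
    -- which the energy bound applies.
    have e2 : pairing g F = pairing (step P g) F := by
      refine (pairing_step_of_const fun x x' y y' hx hy => ?_).symm
      simp only [hF, hbad, step_congr _ hx hy]
    have hεε : (3 : ℝ) * (η / ν) ≤ (ε / 3) ^ 2 := by
      rw [hη]
      field_simp
      norm_num
    have h1 := sum_ite_dev_le (P := P) (f := step P g) hν0 (sqDev_nonneg P Q₁ g) hE₁
      (hen τ P (hτ₁₀.trans hτ₁) hlP) (by positivity) hεε
    have h2 := sum_ite_dev_le (P := P) (f := step P g) hν0 (sqDev_nonneg P Q₂ g) hE₂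
      (hen τ P (hτ₁₀.trans hτ₁) hlP) (by positivity) hεε
    have h3 : pairing (step P g) F ≤ ∑ _x : V, ∑ _y : V, 2 * h +
        pairing (step P g) (fun x y => if ν < step P (sqDev P Q₁ g) x y then 1 else 0) +
        pairing (step P g) (fun x y => if ν < step P (sqDev P Q₂ g) x y then 1 else 0) := by
      simp only [pairing, ← sum_add_distrib]
      refine sum_le_sum fun x _ => sum_le_sum fun y _ => ?_
      have p0 := step_nonneg (r := P) hg0 x y
      have p1 : ∀ d : ℝ, 0 ≤ step P g x y * if ν < d then 1 else 0 := fun d => by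
        split_ifs <;> simp [p0]
      have n1 := p1 (step P (sqDev P Q₁ g) x y)
      have n2 := p1 (step P (sqDev P Q₂ g) x y)
      simp only [hF]
      by_cases hb : bad x y
      · rw [if_pos hb, mul_one]
        rcases hb with hb | hb | hb
        · linarith
        · rw [if_pos hb]
          linarith
        · rw [if_pos hb (c := ν < step P (sqDev P Q₂ g) x y)]
          linarith
      · rw [if_neg hb, mul_zero]
        linarith
    have h4 : ∑ _x : V, ∑ _y : V, 2 * h = ε / 3 * N ^ 2 := by
      simp only [sum_const, card_univ, nsmul_eq_mul, ← hN, hh]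
      ring
    rw [e1, e2]
    linarith
  · by_contra hne
    obtain ⟨v₀, v₁, v₂, v₃, v₄, h01, h12, h23, h34, h40⟩ := exists_of_pentSum_ne_zero hne
    have good : ∀ x y, (if bad x y then 0 else A x y) ≠ 0 → 2 * h ≤ step P g x y ∧
        step P (sqDev P Q₁ g) x y ≤ ν ∧ step P (sqDev P Q₂ g) x y ≤ ν := by
      intro x y hxy
      have : ¬ bad x y := fun hb => hxy (if_pos hb)
      simpa only [hbad, not_or, not_lt] using this
    have hτN : 0 ≤ τ * N := by positivity
    have hprod : (τ * N) ^ 5 ≤ cellCard P v₃ * cellCard P v₄ * cellCard P v₀ * cellCard P v₁ *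
        cellCard P v₂ := by
      have := hlP v₀; have := hlP v₁; have := hlP v₂; have := hlP v₃; have := hlP v₄
      have := cellCard_pos P v₀; have := cellCard_pos P v₁; have := cellCard_pos P v₂
      have := cellCard_pos P v₃; have := cellCard_pos P v₄
      calc (τ * N) ^ 5 = τ * N * (τ * N) * (τ * N) * (τ * N) * (τ * N) := by ring
        _ ≤ _ := by gcongr
    have key := pentSum_ge (L := b / τ ^ 5) (π := 3 / 4 * τ ^ 5) (β := 1 / 20)
      (M := M) (h := h) (C₀ := {y | P v₀ y}) (C₁ := {y | P v₁ y}) (C₂ := {y | P v₂ y})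
      (C₃ := {y | P v₃ y}) (C₄ := {y | P v₄ y}) hA hs hsN hK hrow hcol
      (by
        refine (sum_sq_mul_self_le hA hsN hrow hcol).trans ?_
        rw [hM]
        linarith)
      (by positivity) hh0.le hτ₁0 hl₁ hc₁ hc₂
      (fun x y hxy => ⟨fun hx => P.trans hx (hQ₁ hxy), fun hy => P.trans hy (P.symm (hQ₁ hxy))⟩)
      (fun x y hxy => ⟨fun hx => P.trans hx (hQ₁ hxy), fun hy => P.trans hy (P.symm (hQ₁ hxy))⟩)
      (sum_one_sub_thr_le hh0 (good _ _ h01).1 (good _ _ h01).2.2)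
      (sum_one_sub_thr_le hh0 (good _ _ h12).1 (good _ _ h12).2.2)
      (sum_one_sub_thr_le hh0 (good _ _ h23).1 (good _ _ h23).2.1)
      (sum_one_sub_thr_le hh0 (good _ _ h34).1 (good _ _ h34).2.2)
      (sum_one_sub_thr_le hh0 (good _ _ h40).1 (good _ _ h40).2.2)
      (by
        simp only [sum_ind_cell, ← hN]
        rw [mul_pow] at hprod
        linarith)
    have k7 := (mul_le_mul_of_nonneg_right (count_constants hh0 hK hM0 ha hb hκ₁ hκ₂ hτ₀ hτ₁₀ hτ₁)
      (show 0 ≤ N ^ 3 by positivity)).trans key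
    have : 0 < κ₁ * τ₀ ^ 15 * N ^ 3 := by positivity
    linarith

/-- The pentagon removal lemma for sparse directed graphs. -/
theorem pentagon_removal {ε : ℝ} (hε : 0 < ε) :
    ∃ δ : ℝ, 0 < δ ∧ ∀ (V : Type u) [Fintype V] [Nonempty V] (A : Matrix V V ℝ) (s : ℝ),
      (∀ x y, A x y = 0 ∨ A x y = 1) → 0 < s → s ^ 2 = Fintype.card V →
      rectSum A ≤ δ * Fintype.card V ^ 2 → s * pentSum A ≤ δ * Fintype.card V ^ 3 →
      ∃ A' : Matrix V V ℝ, (∀ x y, A' x y = 0 ∨ A' x y = 1) ∧ (∀ x y, A' x y ≤ A x y) ∧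
        s * ∑ x, ∑ y, (A x y - A' x y) ≤ ε * Fintype.card V ^ 2 ∧ pentSum A' = 0 := by
  -- The squared out-degrees and the squared in-degrees each sum to at most 3N², so discarding edges
  -- at degrees above K s has normalized cost at most 6N²/K, which is half of the budget.
  set K : ℝ := 12 / ε with hK
  have hK0 : 0 < K := by positivity
  obtain ⟨δ, s₀, hδ, H⟩ := pentagon_removal_of_degree_le.{u} (half_pos hε) hK0
  refine ⟨min (min 1 δ) (1 / (2 * (|s₀| + 1) ^ 5)), by positivity, ?_⟩
  intro V _ _ A s hA hs hsN hrect hpent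
  have hN0 : (0 : ℝ) < Fintype.card V := by exact_mod_cast Fintype.card_pos
  set N : ℝ := (Fintype.card V : ℝ) with hN
  have hA0 := nonneg_of_zero_one hA
  by_cases hss : s₀ ≤ s
  · classical
    set A₁ : Matrix V V ℝ := fun x y =>
      if ∑ z, A x z ≤ K * s ∧ ∑ z, A z y ≤ K * s then A x y else 0 with hA₁
    have hA₁01 : ∀ x y, A₁ x y = 0 ∨ A₁ x y = 1 := by
      intro x y
      simp only [hA₁]
      split_ifs
      · exact hA x y
      · exact Or.inl rfl
    have hA₁A : ∀ x y, A₁ x y ≤ A x y := by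
      intro x y
      simp only [hA₁]
      split_ifs
      · rfl
      · exact hA0 x y
    have hA₁0 := nonneg_of_zero_one hA₁01
    have hKs : 0 ≤ K * s := by positivity
    have hrow : ∀ x, ∑ y, A₁ x y ≤ K * s := by
      intro x
      by_cases hx : ∑ z, A x z ≤ K * s
      · exact (sum_le_sum fun y _ => hA₁A x y).trans hx
      · simpa [hA₁, hx] using hKs
    have hcol : ∀ y, ∑ x, A₁ x y ≤ K * s := by
      intro y
      by_cases hy : ∑ z, A z y ≤ K * s
      · exact (sum_le_sum fun x _ => hA₁A x y).trans hy
      · simpa [hA₁, hy] using hKs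
    have hrect1 : rectSum A ≤ N ^ 2 := by
      refine hrect.trans (mul_le_of_le_one_left (by positivity) ?_)
      exact (min_le_left _ _).trans (min_le_left _ _)
    have hδδ : min (min 1 δ) (1 / (2 * (|s₀| + 1) ^ 5)) ≤ δ :=
      (min_le_left _ _).trans (min_le_right _ _)
    obtain ⟨A', h01, hle, hsum, hp⟩ := H V A₁ s hA₁01 hs hss hsN hrow hcol
      ((rectSum_mono hA₁0 hA₁A).trans (hrect.trans
        (mul_le_mul_of_nonneg_right hδδ (by positivity))))
      ((mul_le_mul_of_nonneg_left (pentSum_mono hA₁0 hA₁A) hs.le).trans (hpent.trans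
        (mul_le_mul_of_nonneg_right hδδ (by positivity))))
    refine ⟨A', h01, fun x y => (hle x y).trans (hA₁A x y), ?_, hp⟩
    have d1 := sum_sq_degree_le hA
    have d2 := sum_sq_degree_le (A := Aᵀ) (fun x y => hA y x)
    rw [rectSum_transpose] at d2
    rw [← hN] at d1 d2
    have trunc : ∀ B : Matrix V V ℝ, (∀ x y, 0 ≤ B x y) → ∀ x,
        K * s * ∑ y, (if ∑ z, B x z ≤ K * s then 0 else B x y) ≤ (∑ y, B x y) ^ 2 := by
      intro B hB x
      by_cases hx : ∑ z, B x z ≤ K * s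
      · simpa [hx] using sq_nonneg _
      · simp only [hx, if_false]
        have := sum_nonneg fun y (_ : y ∈ univ) => hB x y
        nlinarith
    have t1 := sum_le_sum fun x (_ : x ∈ univ) => trunc A hA0 x
    have t2 := sum_le_sum fun x (_ : x ∈ univ) => trunc Aᵀ (fun x y => hA0 y x) x
    rw [← mul_sum] at t1 t2
    have t3 : ∑ x, ∑ y, (A x y - A₁ x y) ≤
        ∑ x, ∑ y, (if ∑ z, A x z ≤ K * s then 0 else A x y) +
        ∑ x, ∑ y, (if ∑ z, Aᵀ x z ≤ K * s then 0 else Aᵀ x y) := by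
      rw [sum_comm (f := fun x y => if ∑ z, Aᵀ x z ≤ K * s then 0 else Aᵀ x y),
        ← sum_add_distrib]
      refine sum_le_sum fun x _ => ?_
      rw [← sum_add_distrib]
      refine sum_le_sum fun y _ => ?_
      have := hA0 x y
      simp only [hA₁, transpose_apply]
      by_cases c1 : ∑ z, A x z ≤ K * s <;> by_cases c2 : ∑ z, A z y ≤ K * s <;>
        simp [c1, c2, this]
    have t4 : s * ∑ x, ∑ y, (A x y - A₁ x y) ≤ ε / 2 * N ^ 2 := by
      have : K * (s * ∑ x, ∑ y, (A x y - A₁ x y)) ≤ 6 * N ^ 2 := by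
        have := mul_le_mul_of_nonneg_left t3 hKs
        linarith
      have hKε : K * (ε / 2 * N ^ 2) = 6 * N ^ 2 := by rw [hK]; field_simp; norm_num
      exact le_of_mul_le_mul_left (this.trans hKε.ge) hK0
    have t5 : ∑ x, ∑ y, (A x y - A' x y) =
        ∑ x, ∑ y, (A x y - A₁ x y) + ∑ x, ∑ y, (A₁ x y - A' x y) := by
      simp only [← sum_add_distrib]
      exact sum_congr rfl fun x _ => sum_congr rfl fun y _ => by ring
    rw [t5]
    linarith
  -- For bounded s the hypothesis forces fewer than one closed 5-walk, so nothing need be deleted.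
  · refine ⟨A, hA, fun _ _ => le_rfl, by simpa using by positivity, ?_⟩
    by_contra hne
    obtain ⟨a, b, c, d, e, h1, h2, h3, h4, h5⟩ := exists_of_pentSum_ne_zero hne
    have one_le := one_le_pentSum hA h1 h2 h3 h4 h5
    have hs1 : s ≤ |s₀| + 1 := by linarith [le_abs_self s₀, not_le.1 hss]
    have q1 : s * 1 ≤ 1 / (2 * (|s₀| + 1) ^ 5) * N ^ 3 :=
      (mul_le_mul_of_nonneg_left one_le hs.le).trans (hpent.trans
        (mul_le_mul_of_nonneg_right (min_le_right _ _) (by positivity)))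
    have q2 : s ^ 5 ≤ (|s₀| + 1) ^ 5 := pow_le_pow_left₀ hs.le hs1 5
    rw [← hsN, div_mul_eq_mul_div, le_div_iff₀ (by positivity)] at q1
    have q3 : 0 < s ^ 6 := by positivity
    nlinarith [mul_le_mul_of_nonneg_left q2 hs.le]

end SparseRemoval

/-! ### From graphs to matrices and back. -/

namespace SparseRemoval

open Finset Matrix SimpleGraph

lemma cycle_toSubgraph {V : Type*} {G : SimpleGraph V} {n : ℕ} {f : Fin (n + 2) → V}
    (hf : Function.Injective f) (h : ∀ i, G.Adj (f i) (f (i + 1))) :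
    ∃ H : G.Subgraph, Nonempty (cycleGraph (n + 2) ≃g H.coe) ∧ H.verts = Set.range f := by
  let φ : cycleGraph (n + 2) →g G :=
    { toFun := f
      map_rel' := by
        intro u v huv
        rw [cycleGraph_adj] at huv
        rcases huv with huv | huv
        · obtain rfl := sub_eq_iff_eq_add'.1 huv
          exact (h v).symm
        · obtain rfl := sub_eq_iff_eq_add'.1 huv
          exact h u }
  let c : Copy (cycleGraph (n + 2)) G := ⟨φ, hf⟩
  refine ⟨c.toSubgraph, ⟨c.isoToSubgraph⟩, ?_⟩
  simp only [Copy.toSubgraph, Subgraph.map_verts, Subgraph.verts_top, Set.image_univ]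
  rfl

/-- A family of `k`-tuples of vertices, each contained in a member of a family of `k`-vertex
subgraphs, is not much larger than the family of subgraphs. -/
lemma card_le_pow_mul_ncard {V α : Type*} [Fintype V] {G : SimpleGraph V} {k : ℕ}
    {T : Set G.Subgraph} (hT : ∀ H ∈ T, H.verts.ncard = k) (R : Finset α) {f : α → Fin k → V}
    (hf : Function.Injective f) (h : ∀ p ∈ R, ∃ H ∈ T, ∀ i, f p i ∈ H.verts) :
    #R ≤ k ^ k * T.ncard := by
  classical
  choose! F hF hFv using h
  have hfin : T.Finite := Set.toFinite T
  rw [Set.ncard_eq_toFinset_card T hfin]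
  refine card_le_mul_card_image_of_maps_to (f := F) (fun p hp => by simpa using hF p hp) _ ?_
  intro H hH
  have hk : #H.verts.toFinset = k := by
    rw [← Set.ncard_eq_toFinset_card', hT H (by simpa using hH)]
  -- Each fibre of F consists of k-tuples from a set of k vertices.
  calc #{p ∈ R | F p = H} ≤ #(Fintype.piFinset fun _ : Fin k => H.verts.toFinset) := by
        refine card_le_card_of_injOn f (fun p hp => ?_) hf.injOn
        simp only [coe_filter, Set.mem_ofPred_eq] at hp
        simp only [Fintype.coe_piFinset, Set.mem_pi, Set.mem_univ, forall_const, Set.coe_toFinset]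
        rw [← hp.2]
        exact hFv p hp.1
    _ = k ^ k := by simp [hk]

lemma ncard_verts_of_iso {V : Type*} {G : SimpleGraph V} {k : ℕ} {H : G.Subgraph}
    (h : Nonempty (cycleGraph k ≃g H.coe)) : H.verts.ncard = k := by
  obtain ⟨e⟩ := h
  rw [← Nat.card_coe_set_eq, ← Nat.card_congr e.toEquiv, Nat.card_eq_fintype_card, Fintype.card_fin]

section

variable {V : Type*} [Fintype V] {G : SimpleGraph V} {part : V → ZMod 5}

open scoped Classical in
/-- The adjacency matrix of the edges directed from each part to the next one. -/
noncomputable def cyclicAdj {U : Type*} (G : SimpleGraph U) (part : U → ZMod 5) : Matrix U U ℝ :=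
  fun x y => if G.Adj x y ∧ part y = part x + 1 then 1 else 0

lemma cyclicAdj_zero_one {U : Type*} {G : SimpleGraph U} {part : U → ZMod 5} (x y : U) :
    cyclicAdj G part x y = 0 ∨ cyclicAdj G part x y = 1 := by
  unfold cyclicAdj
  split_ifs <;> simp

lemma cyclicAdj_ne_zero {U : Type*} {G : SimpleGraph U} {part : U → ZMod 5} {x y : U} :
    cyclicAdj G part x y ≠ 0 ↔ G.Adj x y ∧ part y = part x + 1 := by
  simp [cyclicAdj]

lemma rectSum_cyclicAdj_le : rectSum (cyclicAdj G part) ≤ 256 * twoPartC4Count G part := by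
  classical
  set A := cyclicAdj G part with hA
  set R : Finset (V × V × V × V) := {p | (p.2.2.1 ≠ p.2.2.2 ∧ p.1 ≠ p.2.1) ∧ A p.2.2.1 p.1 ≠ 0 ∧
    A p.2.2.1 p.2.1 ≠ 0 ∧ A p.2.2.2 p.1 ≠ 0 ∧ A p.2.2.2 p.2.1 ≠ 0} with hR
  have h1 : rectSum A ≤ #R := by
    rw [hR, card_filter]
    push_cast
    simp only [rectSum, rectPair, ← univ_product_univ, sum_product]
    refine sum_le_sum fun b _ => sum_le_sum fun b' _ => sum_le_sum fun a _ =>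
      sum_le_sum fun a' _ => ?_
    rcases cyclicAdj_zero_one (G := G) (part := part) a b with h1 | h1 <;>
    rcases cyclicAdj_zero_one (G := G) (part := part) a b' with h2 | h2 <;>
    rcases cyclicAdj_zero_one (G := G) (part := part) a' b with h3 | h3 <;>
    rcases cyclicAdj_zero_one (G := G) (part := part) a' b' with h4 | h4 <;>
    simp [hA, h1, h2, h3, h4]
  have h2 : #R ≤ 4 ^ 4 * twoPartC4Count G part := by
    refine card_le_pow_mul_ncard (fun H hH => ncard_verts_of_iso hH.1) R
      (f := fun p => ![p.2.2.1, p.1, p.2.2.2, p.2.1]) ?_ ?_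
    · rintro ⟨b, b', a, a'⟩ ⟨c, c', d, d'⟩ h
      have h0 := congrFun h 0
      have h1 := congrFun h 1
      have h2 := congrFun h 2
      have h3 := congrFun h 3
      simp at h0 h1 h2 h3
      simp [h0, h1, h2, h3]
    · rintro ⟨b, b', a, a'⟩ hp
      simp only [hR, mem_filter, mem_univ, true_and, hA, cyclicAdj_ne_zero] at hp
      obtain ⟨⟨ha, hb⟩, h1, h2, h3, h4⟩ := hp
      have hinj : Function.Injective ![a, b, a', b'] := by
        have := h1.1.ne; have := h2.1.ne; have := h3.1.ne; have := h4.1.ne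
        intro i j hij
        fin_cases i <;> fin_cases j <;> simp_all
      obtain ⟨H, hH, hv⟩ := cycle_toSubgraph (G := G) (n := 2) hinj (by
        intro i
        fin_cases i
        · exact h1.1
        · exact h3.1.symm
        · exact h4.1
        · exact h2.1.symm)
      refine ⟨H, ⟨hH, ?_⟩, fun i => by rw [hv]; exact ⟨i, rfl⟩⟩
      have e : part '' H.verts = {part a, part a + 1} := by
        rw [hv, ← Set.range_comp]
        have e1 : part a' = part a := by
          have := h1.2.symm.trans h3.2
          exact (add_right_cancel this).symm
        ext t
        simp only [Set.mem_range, Set.mem_insert_iff, Set.mem_singleton_iff]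
        constructor
        · rintro ⟨i, rfl⟩
          fin_cases i
          · exact Or.inl rfl
          · exact Or.inr h1.2
          · exact Or.inl e1
          · exact Or.inr h2.2
        · rintro (rfl | rfl)
          · exact ⟨0, rfl⟩
          · exact ⟨1, h1.2⟩
      rw [e, Set.ncard_pair]
      rw [ne_eq, left_eq_add]
      decide
  calc rectSum A ≤ #R := h1
    _ ≤ ((4 ^ 4 * twoPartC4Count G part : ℕ) : ℝ) := by exact_mod_cast h2
    _ = _ := by push_cast; norm_num

/-- A closed directed 5-walk meets each part once, so its vertices are distinct and it spans a
genuine C₅; 3125 = 5⁵ bounds the labellings. -/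
lemma pentSum_cyclicAdj_le : pentSum (cyclicAdj G part) ≤ 3125 * G.copyCount (cycleGraph 5) := by
  classical
  set A := cyclicAdj G part with hA
  set R : Finset (V × V × V × V × V) := {p | A p.1 p.2.1 ≠ 0 ∧ A p.2.1 p.2.2.1 ≠ 0 ∧
    A p.2.2.1 p.2.2.2.1 ≠ 0 ∧ A p.2.2.2.1 p.2.2.2.2 ≠ 0 ∧ A p.2.2.2.2 p.1 ≠ 0} with hR
  have h1 : pentSum A ≤ #R := by
    rw [hR, card_filter]
    push_cast
    simp only [pentSum, ← univ_product_univ, sum_product]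
    refine sum_le_sum fun a _ => sum_le_sum fun b _ => sum_le_sum fun c _ =>
      sum_le_sum fun d _ => sum_le_sum fun e _ => ?_
    rcases cyclicAdj_zero_one (G := G) (part := part) a b with h1 | h1 <;>
    rcases cyclicAdj_zero_one (G := G) (part := part) b c with h2 | h2 <;>
    rcases cyclicAdj_zero_one (G := G) (part := part) c d with h3 | h3 <;>
    rcases cyclicAdj_zero_one (G := G) (part := part) d e with h4 | h4 <;>
    rcases cyclicAdj_zero_one (G := G) (part := part) e a with h5 | h5 <;>
    simp [hA, h1, h2, h3, h4, h5]
  have h2 : #R ≤ 5 ^ 5 * {H : G.Subgraph | Nonempty (cycleGraph 5 ≃g H.coe)}.ncard := by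
    refine card_le_pow_mul_ncard (fun H hH => ncard_verts_of_iso hH) R
      (f := fun p => ![p.1, p.2.1, p.2.2.1, p.2.2.2.1, p.2.2.2.2]) ?_ ?_
    · rintro ⟨a, b, c, d, e⟩ ⟨a', b', c', d', e'⟩ h
      have h0 := congrFun h 0
      have h1 := congrFun h 1
      have h2 := congrFun h 2
      have h3 := congrFun h 3
      have h4 := congrFun h 4
      simp at h0 h1 h2 h3 h4
      simp [h0, h1, h2, h3, h4]
    · rintro ⟨a, b, c, d, e⟩ hp
      simp only [hR, mem_filter, mem_univ, true_and, hA, cyclicAdj_ne_zero] at hp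
      obtain ⟨h1, h2, h3, h4, h5⟩ := hp
      have hpart : ∀ i : Fin 5, part (![a, b, c, d, e] i) = part a + (i.val : ZMod 5) := by
        intro i
        fin_cases i
        · simp
        · simpa using h1.2
        · change part c = _
          rw [h2.2, h1.2, add_assoc]
          rfl
        · change part d = _
          rw [h3.2, h2.2, h1.2, add_assoc, add_assoc]
          rfl
        · change part e = _
          rw [h4.2, h3.2, h2.2, h1.2, add_assoc, add_assoc, add_assoc]
          rfl
      have hinj : Function.Injective ![a, b, c, d, e] := by
        intro i j hij
        have h := congrArg part hij
        rw [hpart, hpart] at h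
        have hc : ∀ i j : Fin 5, (i.val : ZMod 5) = (j.val : ZMod 5) → i = j := by decide
        exact hc i j (add_left_cancel h)
      obtain ⟨H, hH, hv⟩ := cycle_toSubgraph (G := G) (n := 3) hinj (by
        intro i
        fin_cases i
        · exact h1.1
        · exact h2.1
        · exact h3.1
        · exact h4.1
        · exact h5.1)
      exact ⟨H, hH, fun i => by rw [hv]; exact ⟨i, rfl⟩⟩
  have h3 : {H : G.Subgraph | Nonempty (cycleGraph 5 ≃g H.coe)}.ncard =
      G.copyCount (cycleGraph 5) := by
    rw [copyCount, ← Set.ncard_coe_finset]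
    simp
  rw [h3] at h2
  calc pentSum A ≤ #R := h1
    _ ≤ ((5 ^ 5 * G.copyCount (cycleGraph 5) : ℕ) : ℝ) := by exact_mod_cast h2
    _ = _ := by push_cast; norm_num

end

/-- A closed walk of length five in the cyclic group of order five goes around the cycle. -/
lemma cyclic_walk {p : Fin 5 → ZMod 5} (h : ∀ i, p (i + 1) = p i + 1 ∨ p i = p (i + 1) + 1) :
    (∀ i, p (i + 1) = p i + 1) ∨ ∀ i, p i = p (i + 1) + 1 := by
  -- A sum of five signs is odd and between −5 and 5, so it is divisible by 5 only at ±5; checked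
  -- over the 32 cases.
  have key : ∀ d₀ : ZMod 5, (d₀ = 1 ∨ d₀ = -1) → ∀ d₁ : ZMod 5, (d₁ = 1 ∨ d₁ = -1) →
      ∀ d₂ : ZMod 5, (d₂ = 1 ∨ d₂ = -1) → ∀ d₃ : ZMod 5, (d₃ = 1 ∨ d₃ = -1) →
      ∀ d₄ : ZMod 5, (d₄ = 1 ∨ d₄ = -1) → d₀ + d₁ + d₂ + d₃ + d₄ = 0 →
      (d₀ = 1 ∧ d₁ = 1 ∧ d₂ = 1 ∧ d₃ = 1 ∧ d₄ = 1) ∨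
        (d₀ = -1 ∧ d₁ = -1 ∧ d₂ = -1 ∧ d₃ = -1 ∧ d₄ = -1) := by
    rintro _ (rfl | rfl) _ (rfl | rfl) _ (rfl | rfl) _ (rfl | rfl) _ (rfl | rfl) <;> decide
  have hd : ∀ i, p (i + 1) - p i = 1 ∨ p (i + 1) - p i = -1 := fun i => by
    rcases h i with h | h
    · left; rw [h]; ring
    · right; rw [h]; ring
  have := key _ (hd 0) _ (hd 1) _ (hd 2) _ (hd 3) _ (hd 4) (by
    have : (4 + 1 : Fin 5) = 0 := rfl
    rw [this]
    change p 1 - p 0 + (p 2 - p 1) + (p 3 - p 2) + (p 4 - p 3) + (p 0 - p 4) = 0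
    ring)
  rcases this with ⟨h0, h1, h2, h3, h4⟩ | ⟨h0, h1, h2, h3, h4⟩
  · refine Or.inl fun i => ?_
    have : p (i + 1) - p i = 1 := by fin_cases i <;> assumption
    rw [← this]; ring
  · refine Or.inr fun i => ?_
    have : p (i + 1) - p i = -1 := by fin_cases i <;> assumption
    linear_combination -this

lemma card_eq_of_isCyclicFivePartite {V : Type*} [Fintype V] {G : SimpleGraph V}
    {part : V → ZMod 5} {n : ℕ} (h : IsCyclicFivePartite G part n) : Fintype.card V = 5 * n := by
  classical
  rw [← card_univ, card_eq_sum_card_fiberwise (f := part) (t := univ) (fun _ _ => by simp)]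
  have : ∀ i, #{v | part v = i} = n := fun i => by
    rw [← h.ncard_part i, ← Set.ncard_coe_finset]
    simp
  simp only [this, sum_const, card_univ, ZMod.card, smul_eq_mul]

/-- If a subset of the directed edges contains no closed walk of length five, then the graph
without the remaining edges contains no pentagon. -/
lemma cycleGraph_five_free {V : Type*} [Fintype V] {G : SimpleGraph V} {part : V → ZMod 5} {n : ℕ}
    (hG : IsCyclicFivePartite G part n) {A' : Matrix V V ℝ}
    (hA' : ∀ x y, A' x y = 0 ∨ A' x y = 1) (hp : pentSum A' = 0) {S : Set (Sym2 V)}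
    (hS : ∀ x y, cyclicAdj G part x y ≠ 0 → A' x y = 0 → s(x, y) ∈ S) :
    (cycleGraph 5).Free (G.deleteEdges S) := by
  rintro ⟨c⟩
  have hadj : ∀ i : Fin 5, (G.deleteEdges S).Adj (c i) (c (i + 1)) := fun i =>
    c.toHom.map_adj (by rw [cycleGraph_adj]; right; exact add_sub_cancel_left i 1)
  have hA : ∀ x y, (G.deleteEdges S).Adj x y → part y = part x + 1 → A' x y ≠ 0 := by
    intro x y hxy hpart h0
    rw [deleteEdges_adj] at hxy
    exact hxy.2 (hS x y (cyclicAdj_ne_zero.2 ⟨hxy.1, hpart⟩) h0)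
  have hcyc := cyclic_walk (p := fun i => part (c i))
    (fun i => hG.adj _ _ ((deleteEdges_adj.1 (hadj i)).1))
  have : 1 ≤ pentSum A' := by
    -- A pentagon traversed backwards is read in the opposite direction to obtain a directed closed
    -- walk.
    rcases hcyc with h | h
    · exact one_le_pentSum hA' (hA _ _ (hadj 0) (h 0)) (hA _ _ (hadj 1) (h 1))
        (hA _ _ (hadj 2) (h 2)) (hA _ _ (hadj 3) (h 3)) (hA _ _ (hadj 4) (h 4))
    · exact one_le_pentSum hA' (hA _ _ (hadj 4).symm (h 4)) (hA _ _ (hadj 3).symm (h 3))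
        (hA _ _ (hadj 2).symm (h 2)) (hA _ _ (hadj 1).symm (h 1)) (hA _ _ (hadj 0).symm (h 0))
  linarith

end SparseRemoval

/-! ### The removal theorem for graphs. -/

theorem mainTheorem3 : ∀ ε : ℝ, 0 < ε → ∃ δ : ℝ, 0 < δ ∧
    ∀ (n : ℕ) (V : Type*) [Fintype V] (G : SimpleGraph V) (part : V → ZMod 5),
      IsCyclicFivePartite G part n →
      (twoPartC4Count G part : ℝ) ≤ δ * (n : ℝ) ^ 2 →
      (G.copyCount (SimpleGraph.cycleGraph 5) : ℝ) ≤ δ * (n : ℝ) ^ (5 / 2 : ℝ) →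
      ∃ S : Finset (Sym2 V), (S : Set (Sym2 V)) ⊆ G.edgeSet ∧
        (S.card : ℝ) ≤ ε * (n : ℝ) ^ (3 / 2 : ℝ) ∧
        (SimpleGraph.cycleGraph 5).Free (G.deleteEdges (S : Set (Sym2 V))) := by
  intro ε hε
  -- N² = 25n² accounts for ε/25. The divisor 125 in δ/125 comes from pentagons: 3125/125 = 25, and
  -- s² = 5n supplies the remaining 5 of N³ = 125n³.
  obtain ⟨δ, hδ, H⟩ := SparseRemoval.pentagon_removal (ε := ε / 25) (by positivity)
  refine ⟨δ / 125, by positivity, ?_⟩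
  intro n V _ G part hG hC4 hC5
  classical
  have hcard := SparseRemoval.card_eq_of_isCyclicFivePartite hG
  rcases Nat.eq_zero_or_pos n with rfl | hn
  · have hV : IsEmpty V := Fintype.card_eq_zero_iff.1 (by simpa using hcard)
    exact ⟨∅, by simp, by simp, fun ⟨c⟩ => hV.elim (c 0)⟩
  have hV : Nonempty V := Fintype.card_pos_iff.1 (by omega)
  set m : ℝ := (n : ℝ) with hm
  have hm0 : 0 < m := by rw [hm]; exact_mod_cast hn
  have hcard' : (Fintype.card V : ℝ) = 5 * m := by rw [hcard]; push_cast; rfl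
  set t : ℝ := √m with ht
  have ht0 : 0 < t := Real.sqrt_pos.2 hm0
  have htt : t ^ 2 = m := Real.sq_sqrt hm0.le
  have hpow5 : m ^ (5 / 2 : ℝ) = t ^ 5 := by
    rw [ht, Real.sqrt_eq_rpow, ← Real.rpow_natCast, ← Real.rpow_mul hm0.le]
    norm_num
  have hpow3 : m ^ (3 / 2 : ℝ) = t ^ 3 := by
    rw [ht, Real.sqrt_eq_rpow, ← Real.rpow_natCast, ← Real.rpow_mul hm0.le]
    norm_num
  rw [hpow5] at hC5
  rw [hpow3]
  set s : ℝ := √(5 * m) with hs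
  have hs0 : 0 < s := Real.sqrt_pos.2 (by positivity)
  have hss : s ^ 2 = 5 * m := Real.sq_sqrt (by positivity)
  have hts : t ≤ s := Real.sqrt_le_sqrt (by linarith)
  set A := SparseRemoval.cyclicAdj G part with hA
  have hA01 : ∀ x y, A x y = 0 ∨ A x y = 1 := SparseRemoval.cyclicAdj_zero_one
  have hrect : SparseRemoval.rectSum A ≤ δ * (Fintype.card V : ℝ) ^ 2 := by
    have h1 : SparseRemoval.rectSum A ≤ _ := SparseRemoval.rectSum_cyclicAdj_le
    rw [hcard']
    have h2 : 0 < δ * m ^ 2 := by positivity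
    linarith
  have hpent : s * SparseRemoval.pentSum A ≤ δ * (Fintype.card V : ℝ) ^ 3 := by
    have h1 : SparseRemoval.pentSum A ≤ _ := SparseRemoval.pentSum_cyclicAdj_le
    have h2 : SparseRemoval.pentSum A ≤ 25 * δ * t ^ 4 * s := by
      have : 25 * δ * t ^ 4 * t ≤ 25 * δ * t ^ 4 * s := by gcongr
      linarith
    calc s * SparseRemoval.pentSum A ≤ s * (25 * δ * t ^ 4 * s) := by gcongr
      _ = 25 * δ * (t ^ 2) ^ 2 * s ^ 2 := by ring
      _ = δ * (Fintype.card V : ℝ) ^ 3 := by rw [htt, hss, hcard']; ring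
  obtain ⟨A', hA', hle, hsum, hp⟩ := H V A s hA01 hs0 (hss.trans hcard'.symm) hrect hpent
  set F : Finset (V × V) := {p | A p.1 p.2 ≠ 0 ∧ A' p.1 p.2 = 0} with hF
  have hFcard : (F.card : ℝ) = ∑ x, ∑ y, (A x y - A' x y) := by
    rw [hF, Finset.card_filter]
    push_cast
    rw [← Finset.univ_product_univ, Finset.sum_product]
    refine Finset.sum_congr rfl fun x _ => Finset.sum_congr rfl fun y _ => ?_
    have := hle x y
    rcases hA01 x y with h | h <;> rcases hA' x y with h' | h' <;> simp [h, h']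
    linarith
  refine ⟨F.image fun p => s(p.1, p.2), ?_, ?_, ?_⟩
  · intro e he
    simp only [Finset.coe_image, Set.mem_image, Finset.mem_coe, hF, Finset.mem_filter,
      Finset.mem_univ, true_and] at he
    obtain ⟨p, hp, rfl⟩ := he
    exact (SparseRemoval.cyclicAdj_ne_zero.1 hp.1).1
  · refine (Nat.cast_le.2 Finset.card_image_le).trans ?_
    have h1 : (F.card : ℝ) * t ≤ ε * t ^ 3 * t := by
      calc (F.card : ℝ) * t ≤ s * F.card := by rw [mul_comm]; gcongr
        _ ≤ ε / 25 * (Fintype.card V : ℝ) ^ 2 := by rw [hFcard]; exact hsum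
        _ = ε * t ^ 3 * t := by rw [hcard', ← htt]; ring
    exact le_of_mul_le_mul_right h1 ht0
  · refine SparseRemoval.cycleGraph_five_free hG hA' hp fun x y hxy h0 => ?_
    simp only [Finset.coe_image, Set.mem_image, Finset.mem_coe, hF, Finset.mem_filter,
      Finset.mem_univ, true_and]
    exact ⟨(x, y), ⟨hxy, h0⟩, rfl⟩
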